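/- Let $0<\beta<1$. Let $M_\beta(z)=\sum_{n=0}^\infty \frac{(-z)^n}{n!\,\Gamma(-\beta n+1-\beta)}$ ($z\in\mathbb{C}$, with $1/\Gamma=0$ at the poles of $\Gamma$) be the $M$-Wright function and $E_\beta(z)=\sum_{n=0}^\infty \frac{z^n}{\Gamma(\beta n+1)}$ the Mittag-Leffler function. For $\rho\ge \tfrac12$ and $z\in\mathbb{C}\setminus\{0\}$ let $$H^{1\,1}_{1\,2}\left(z\,\middle|\,\begin{matrix}(1-\rho,1)\\(0,1),(\beta(1-\rho),\beta)\end{matrix}\right)=\frac1{2\pi i}\int_{\mathcal L}\frac{\Gamma(s)\,\Gamma(\rho-s)}{\Gamma(1-\beta(1-\rho)-\beta s)}\,z^{-s}\,ds$$ be the Fox $H$-function, where $\mathcal L$ is a loop that begins at $-\infty+i\varphi_1$, ends at $-\infty+i\varphi_2$ with $\varphi_1<0<\varphi_2$, and encircles all the poles of $\Gamma(s)$ once in the positive direction but none of the poles of $\Gamma(\rho-s)$; at $z=0$ the function is defined by holomorphic extension. Then for all $\rho\ge\tfrac12$ and all $z\in\mathbb{C}$ the integral below converges absolutely and $$\int_0^\infty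 M_\beta(r)\,r^{\rho-1}e^{-rz}\,dr = H^{1\,1}_{1\,2}\left(z\,\middle|\,\begin{matrix}(1-\rho,1)\\(0,1),(\beta(1-\rho),\beta)\end{matrix}\right)=\sum_{k=0}^\infty\frac{(-z)^k\,\Gamma(\rho+k)}{k!\,\Gamma(1-\beta+\beta\rho+\beta k)}.$$ In particular, for all $z\in\mathbb{C}$, $$\int_0^\infty M_\beta(r)\,e^{-rz}\,dr=E_\beta(-z).$$ -/

import Mathlib

open scoped Topology

/-- The Mittag-Leffler function `E_β(z) = ∑ zⁿ / Γ(β n + 1)`. -/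
noncomputable def mittagLeffler (β : ℝ) (z : ℂ) : ℂ :=
  ∑' n : ℕ, z ^ n / Complex.Gamma ((β : ℂ) * n + 1)

/-- The `M`-Wright function `M_β(z) = ∑ (-z)ⁿ / (n! Γ(-β n + 1 - β))`.
At a pole of `Γ` the summand is `0`, as it should be, because `Complex.Gamma` is `0` there
and division by `0` gives `0`. -/
noncomputable def mWright (β : ℝ) (z : ℂ) : ℂ :=
  ∑' n : ℕ, (-z) ^ n / ((n.factorial : ℂ) * Complex.Gamma (-(β : ℂ) * n + 1 - β))

/-- The parameters `(a₁,A₁),…,(a_p,A_p)` and `(b₁,B₁),…,(b_q,B_q)` of a Fox function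
`H^{m n}_{p q}`. -/
structure FoxParams (m n p q : ℕ) where
  a : Fin p → ℂ
  A : Fin p → ℝ
  b : Fin q → ℂ
  B : Fin q → ℝ

namespace FoxParams

variable {m n p q : ℕ}

/-- The standing conditions on the parameters, in the case `∑ A < ∑ B`, in which the contour of
the Fox function is a loop that begins and ends at `-∞`. -/
def Valid (P : FoxParams m n p q) : Prop :=
  n ≤ p ∧ 1 ≤ m ∧ m ≤ q ∧ (∀ j, 0 < P.A j) ∧ (∀ j, 0 < P.B j) ∧ ∑ j, P.A j < ∑ j, P.B j

/-- The Mellin-Barnes kernel `Θ(s)`. -/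
noncomputable def theta (P : FoxParams m n p q) (s : ℂ) : ℂ :=
  ((∏ j ∈ Finset.univ.filter (fun j : Fin q => (j : ℕ) < m), Complex.Gamma (P.b j + s * P.B j)) *
      ∏ j ∈ Finset.univ.filter (fun j : Fin p => (j : ℕ) < n), Complex.Gamma (1 - P.a j - s * P.A j)) /
    ((∏ j ∈ Finset.univ.filter (fun j : Fin q => m ≤ (j : ℕ)), Complex.Gamma (1 - P.b j - s * P.B j)) *
      ∏ j ∈ Finset.univ.filter (fun j : Fin p => n ≤ (j : ℕ)), Complex.Gamma (P.a j + s * P.A j))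

/-- The integrand `Θ(s) z^{-s}`, with the principal branch of the power. -/
noncomputable def integrand (P : FoxParams m n p q) (z s : ℂ) : ℂ :=
  P.theta s * z ^ (-s)

/-- The loop `-∞ + iφ₁ → γ + iφ₁ → γ + iφ₂ → -∞ + iφ₂` encircles, in the positive direction, all
the poles of `Γ(b_j + s B_j)`, `j ≤ m`, and none of the poles of `Γ(1 - a_j - s A_j)`, `j ≤ n`
(and it passes through none of them). -/
def IsLoop (P : FoxParams m n p q) (γ φ₁ φ₂ : ℝ) : Prop :=
  φ₁ < φ₂ ∧
  (∀ j : Fin q, (j : ℕ) < m → ∀ (k : ℕ) (s : ℂ), P.b j + s * P.B j = -(k : ℂ) →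
    s.re < γ ∧ φ₁ < s.im ∧ s.im < φ₂) ∧
  (∀ j : Fin p, (j : ℕ) < n → ∀ (k : ℕ) (s : ℂ), 1 - P.a j - s * P.A j = -(k : ℂ) →
    ¬ (s.re ≤ γ ∧ φ₁ ≤ s.im ∧ s.im ≤ φ₂))

/-- The integral over the loop converges absolutely. -/
def LoopIntegrable (P : FoxParams m n p q) (z : ℂ) (γ φ₁ φ₂ : ℝ) : Prop :=
  MeasureTheory.IntegrableOn
    (fun x : ℝ => P.integrand z ((x : ℂ) + φ₁ * Complex.I)) (Set.Iic γ) ∧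
  IntervalIntegrable
    (fun y : ℝ => P.integrand z ((γ : ℂ) + y * Complex.I)) MeasureTheory.volume φ₁ φ₂ ∧
  MeasureTheory.IntegrableOn
    (fun x : ℝ => P.integrand z ((x : ℂ) + φ₂ * Complex.I)) (Set.Iic γ)

/-- `(1 / 2πi) ∫ Θ(s) z^{-s} ds` over the loop. -/
noncomputable def loopIntegral (P : FoxParams m n p q) (z : ℂ) (γ φ₁ φ₂ : ℝ) : ℂ :=
  (1 / (2 * (Real.pi : ℂ) * Complex.I)) *
    ((∫ x in Set.Iic γ, P.integrand z ((x : ℂ) + φ₁ * Complex.I)) +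
      Complex.I * (∫ y in φ₁..φ₂, P.integrand z ((γ : ℂ) + y * Complex.I)) -
      ∫ x in Set.Iic γ, P.integrand z ((x : ℂ) + φ₂ * Complex.I))

/-- The Mellin-Barnes integral at `z` is `w`: an admissible loop exists, and over every admissible
loop the integral converges absolutely and has the value `w`. -/
def HasContourValue (P : FoxParams m n p q) (z w : ℂ) : Prop :=
  (∃ γ φ₁ φ₂ : ℝ, P.IsLoop γ φ₁ φ₂) ∧
  ∀ γ φ₁ φ₂ : ℝ, P.IsLoop γ φ₁ φ₂ →
    P.LoopIntegrable z γ φ₁ φ₂ ∧ P.loopIntegral z γ φ₁ φ₂ = w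

/-- The Fox function is defined at `z` and has the value `w` there: for `z ≠ 0` through the
Mellin-Barnes integral, at `z = 0` through the holomorphic extension. -/
def HasFoxH (P : FoxParams m n p q) (z w : ℂ) : Prop :=
  P.Valid ∧
  ((z ≠ 0 ∧ P.HasContourValue z w) ∨
    (z = 0 ∧ ∃ h : ℂ → ℂ, AnalyticAt ℂ h 0 ∧ h 0 = w ∧
      ∀ᶠ u in 𝓝[≠] (0 : ℂ), P.HasContourValue u (h u)))

open Classical in
/-- The Fox function `H^{m n}_{p q}`, with the value `0` where it is not defined. -/
noncomputable def foxH (P : FoxParams m n p q) (z : ℂ) : ℂ :=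
  if h : ∃ w, P.HasFoxH z w then h.choose else 0

theorem HasContourValue.unique {P : FoxParams m n p q} {z w w' : ℂ}
    (h : P.HasContourValue z w) (h' : P.HasContourValue z w') : w = w' := by
  obtain ⟨⟨γ, φ₁, φ₂, hL⟩, h⟩ := h
  rw [← (h γ φ₁ φ₂ hL).2, ← (h'.2 γ φ₁ φ₂ hL).2]

theorem HasFoxH.unique {P : FoxParams m n p q} {z w w' : ℂ}
    (h : P.HasFoxH z w) (h' : P.HasFoxH z w') : w = w' := by
  rcases h with ⟨-, ⟨hz, h⟩ | ⟨hz, f, hf, rfl, h⟩⟩ <;>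
    rcases h' with ⟨-, ⟨hz', h'⟩ | ⟨hz', g, hg, rfl, h'⟩⟩
  · exact h.unique h'
  · exact absurd hz' hz
  · exact absurd hz hz'
  · have e : f =ᶠ[𝓝[≠] (0 : ℂ)] g := by
      filter_upwards [h, h'] with u hu hu'
      exact hu.unique hu'
    have hf' := hf.continuousAt.tendsto.mono_left (nhdsWithin_le_nhds (s := {0}ᶜ))
    have hg' := hg.continuousAt.tendsto.mono_left (nhdsWithin_le_nhds (s := {0}ᶜ))
    exact tendsto_nhds_unique (hf'.congr' e) hg'

theorem HasFoxH.foxH_eq {P : FoxParams m n p q} {z w : ℂ} (h : P.HasFoxH z w) :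
    P.foxH z = w := by
  have h' : ∃ w, P.HasFoxH z w := ⟨w, h⟩
  rw [foxH, dif_pos h']
  exact h'.choose_spec.unique h

end FoxParams

/-- The parameters of `H^{1 1}_{1 2}( · | (1-ρ,1) ; (0,1), (β(1-ρ),β))`. -/
noncomputable def laplaceFoxParams (β ρ : ℝ) : FoxParams 1 1 1 2 where
  a := ![1 - (ρ : ℂ)]
  A := ![1]
  b := ![0, (β : ℂ) * (1 - ρ)]
  B := ![1, β]

/-!
Writing `1 / Γ(1 - x)` as the imaginary part of `π⁻¹ exp (π i x) Γ(x)` and `Γ` as the Euler integral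
along a ray `exp (i θ) (0, ∞)` with `π / 2 < θ < π`, one sums the series of `M_β` to a Hankel-type
integral, which we parametrise by the logarithm of the contour variable. If also
`β θ < π / 2`, moving the contour shows that `M_β(r)` decays faster than every exponential, and
exchanging integrals gives the moments `∫ M_β(r) r ^ (s - 1) dr = Γ(s) / Γ(1 - β + β s)`, first for
`0 < s < 1` and then for `0 < Re s` by analytic continuation. Expanding `exp (-r z)` and integrating
term by term turns the Laplace integral into the power series in `z`. On the other side, the
Mellin-Barnes integral over the loop is the sum of the residues of its integrand at the poles
`s = -k` of `Γ(s)`, because the integrand is small on the segments `Re s = -n - 1 / 2`; these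
residues are the terms of the same power series.
-/

open Complex Filter MeasureTheory Set
open scoped Real

/-! ### Residues in rectangles and half-strips -/

section Rectangle

variable {f g : ℂ → ℂ} {a b c d : ℝ}

/-- The boundary of the rectangle `[a, b] × [c, d]`, the set on which
`rectBoundaryIntegral f a b c d` depends. -/
def rectBoundary (a b c d : ℝ) : Set ℂ :=
  Icc a b ×ℂ {c, d} ∪ {a, b} ×ℂ Icc c d

/-- The integral of `f` over the positively oriented boundary of `[a, b] × [c, d]`. -/
noncomputable def rectBoundaryIntegral (f : ℂ → ℂ) (a b c d : ℝ) : ℂ :=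
  (∫ x in a..b, f (x + c * I)) - (∫ x in a..b, f (x + d * I)) +
    I * (∫ y in c..d, f (b + y * I)) - I * (∫ y in c..d, f (a + y * I))

theorem rectBoundaryIntegral_eq_zero
    (hf : DifferentiableOn ℂ f (uIcc a b ×ℂ uIcc c d)) :
    rectBoundaryIntegral f a b c d = 0 := by
  have h := integral_boundary_rect_eq_zero_of_differentiableOn f
    (a + c * I) (b + d * I) (by simpa using hf)
  simpa [rectBoundaryIntegral] using h

theorem horizontal_mem_rectBoundary {x y : ℝ} (hx : x ∈ Icc a b) (hy : y = c ∨ y = d) :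
    (x + y * I : ℂ) ∈ rectBoundary a b c d :=
  Or.inl ⟨by simpa using hx, by simpa using hy⟩

theorem vertical_mem_rectBoundary {x y : ℝ} (hx : x = a ∨ x = b) (hy : y ∈ Icc c d) :
    (x + y * I : ℂ) ∈ rectBoundary a b c d :=
  Or.inr ⟨by simpa using hx, by simpa using hy⟩

theorem rectBoundary_subset (hab : a ≤ b) (hcd : c ≤ d) :
    rectBoundary a b c d ⊆ Icc a b ×ℂ Icc c d := by
  rintro s (⟨hre, him⟩ | ⟨hre, him⟩)
  · exact ⟨hre, pair_subset (left_mem_Icc.2 hcd) (right_mem_Icc.2 hcd) him⟩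
  · exact ⟨pair_subset (left_mem_Icc.2 hab) (right_mem_Icc.2 hab) hre, him⟩

theorem notMem_rectBoundary {p : ℂ} (ha : a < p.re) (hb : p.re < b) (hc : c < p.im)
    (hd : p.im < d) : p ∉ rectBoundary a b c d := by
  rintro (⟨-, him⟩ | ⟨hre, -⟩)
  · rcases him with him | him
    exacts [hc.ne' him, hd.ne him]
  · rcases hre with hre | hre
    exacts [ha.ne' hre, hb.ne hre]

theorem rectBoundaryIntegral_congr (hab : a ≤ b) (hcd : c ≤ d)
    (h : EqOn f g (rectBoundary a b c d)) :
    rectBoundaryIntegral f a b c d = rectBoundaryIntegral g a b c d := by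
  have horizontal (y : ℝ) (hy : y = c ∨ y = d) :
      ∫ x in a..b, f (x + y * I) = ∫ x in a..b, g (x + y * I) :=
    intervalIntegral.integral_congr fun x hx =>
      h (horizontal_mem_rectBoundary (by rwa [uIcc_of_le hab] at hx) hy)
  have vertical (x : ℝ) (hx : x = a ∨ x = b) :
      ∫ y in c..d, f (x + y * I) = ∫ y in c..d, g (x + y * I) :=
    intervalIntegral.integral_congr fun y hy =>
      h (vertical_mem_rectBoundary hx (by rwa [uIcc_of_le hcd] at hy))
  simp only [rectBoundaryIntegral, horizontal c (.inl rfl), horizontal d (.inr rfl),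
    vertical a (.inl rfl), vertical b (.inr rfl)]

theorem intervalIntegrable_horizontal (hab : a ≤ b) (hf : ContinuousOn f (rectBoundary a b c d))
    {y : ℝ} (hy : y = c ∨ y = d) :
    IntervalIntegrable (fun x : ℝ => f (x + y * I)) volume a b :=
  ContinuousOn.intervalIntegrable <| hf.comp (by fun_prop) fun x hx =>
    horizontal_mem_rectBoundary (by rwa [uIcc_of_le hab] at hx) hy

theorem intervalIntegrable_vertical (hcd : c ≤ d) (hf : ContinuousOn f (rectBoundary a b c d))
    {x : ℝ} (hx : x = a ∨ x = b) :
    IntervalIntegrable (fun y : ℝ => f (x + y * I)) volume c d :=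
  ContinuousOn.intervalIntegrable <| hf.comp (by fun_prop) fun y hy =>
    vertical_mem_rectBoundary hx (by rwa [uIcc_of_le hcd] at hy)

theorem rectBoundaryIntegral_const_mul_add (hab : a ≤ b) (hcd : c ≤ d)
    (hf : ContinuousOn f (rectBoundary a b c d)) (hg : ContinuousOn g (rectBoundary a b c d))
    (w : ℂ) :
    rectBoundaryIntegral (fun s => w * f s + g s) a b c d =
      w * rectBoundaryIntegral f a b c d + rectBoundaryIntegral g a b c d := by
  have horizontal (y : ℝ) (hy : y = c ∨ y = d) :
      ∫ x in a..b, (w * f (x + y * I) + g (x + y * I)) =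
        w * (∫ x in a..b, f (x + y * I)) + ∫ x in a..b, g (x + y * I) := by
    rw [intervalIntegral.integral_add ((intervalIntegrable_horizontal hab hf hy).const_mul w)
      (intervalIntegrable_horizontal hab hg hy), intervalIntegral.integral_const_mul]
  have vertical (x : ℝ) (hx : x = a ∨ x = b) :
      ∫ y in c..d, (w * f (x + y * I) + g (x + y * I)) =
        w * (∫ y in c..d, f (x + y * I)) + ∫ y in c..d, g (x + y * I) := by
    rw [intervalIntegral.integral_add ((intervalIntegrable_vertical hcd hf hx).const_mul w)
      (intervalIntegrable_vertical hcd hg hx), intervalIntegral.integral_const_mul]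
  simp only [rectBoundaryIntegral, horizontal c (.inl rfl), horizontal d (.inr rfl),
    vertical a (.inl rfl), vertical b (.inr rfl)]
  ring

theorem log_neg_of_im_pos {z : ℂ} (hz : 0 < z.im) : log (-z) = log z - π * I := by
  apply Complex.ext <;> simp [log_re, log_im, arg_neg_eq_arg_sub_pi_of_im_pos hz]

theorem log_neg_of_im_neg {z : ℂ} (hz : z.im < 0) : log (-z) = log z + π * I := by
  apply Complex.ext <;> simp [log_re, log_im, arg_neg_eq_arg_add_pi_of_im_neg hz]

theorem mul_integral_inv_segment {z v : ℂ} (h : ∀ t : ℝ, z + t * v ∈ slitPlane) :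
    v * ∫ t in a..b, (z + t * v)⁻¹ = log (z + b * v) - log (z + a * v) := by
  rw [← intervalIntegral.integral_const_mul]
  refine intervalIntegral.integral_eq_sub_of_hasDerivAt
    (f := fun t : ℝ => log (z + t * v)) (fun t _ => ?_) ?_
  · have hderiv : HasDerivAt (fun t : ℝ => z + t * v) v t := by
      simpa using ((ofRealCLM.hasDerivAt (x := t)).mul_const v).const_add z
    simpa [div_eq_mul_inv] using hderiv.clog_real (h t)
  · exact (continuous_const.mul ((by fun_prop : Continuous fun t : ℝ => z + t * v).inv₀
      fun t => slitPlane_ne_zero (h t))).intervalIntegrable _ _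

theorem rectBoundaryIntegral_inv_sub {p : ℂ} (ha : a < p.re) (hb : p.re < b) (hc : c < p.im)
    (hd : p.im < d) :
    rectBoundaryIntegral (fun s => (s - p)⁻¹) a b c d = 2 * π * I := by
  have horizontal (y : ℝ) (hy : y ≠ p.im) :
      ∫ x in a..b, (x + y * I - p)⁻¹ = log (b + y * I - p) - log (a + y * I - p) := by
    have h := mul_integral_inv_segment (a := a) (b := b) (z := y * I - p) (v := 1)
      fun x => .inr (by simpa using sub_ne_zero.2 hy)
    simpa only [one_mul, mul_one, add_comm _ (ofReal _), ← add_sub_assoc] using h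
  have right : I * ∫ y in c..d, (b + y * I - p)⁻¹ = log (b + d * I - p) - log (b + c * I - p) := by
    have h := mul_integral_inv_segment (a := c) (b := d) (z := b - p) (v := I)
      fun y => .inl (by simpa using hb)
    simpa only [sub_add_eq_add_sub] using h
  have left : I * ∫ y in c..d, (a + y * I - p)⁻¹ =
      log (-(a + d * I - p)) - log (-(a + c * I - p)) := by
    have h := mul_integral_inv_segment (a := c) (b := d) (z := -(a - p)) (v := -I)
      fun y => .inl (by simpa using ha)
    simpa only [mul_neg, ← neg_add, inv_neg, intervalIntegral.integral_neg, neg_mul, neg_neg,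
      sub_add_eq_add_sub] using h
  rw [rectBoundaryIntegral, horizontal c hc.ne, horizontal d hd.ne', right, left,
    log_neg_of_im_pos (by simpa using hd), log_neg_of_im_neg (by simpa using hc)]
  ring

theorem exists_differentiableOn_eq_simplePole_add {R : Set ℂ} {p w : ℂ} (hR : R ∈ 𝓝 p)
    (hf : DifferentiableOn ℂ f (R \ {p}))
    (hw : Tendsto (fun s => (s - p) * f s) (𝓝[≠] p) (𝓝 w)) :
    ∃ g, DifferentiableOn ℂ g R ∧ EqOn f (fun s => w * (s - p)⁻¹ + g s) {p}ᶜ := by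
  set F : ℂ → ℂ := Function.update (fun s => (s - p) * f s) p w with hF
  have hFd : DifferentiableOn ℂ F R := by
    rw [← differentiableOn_compl_singleton_and_continuousAt_iff hR]
    refine ⟨DifferentiableOn.congr (f := fun s => (s - p) * f s) (by fun_prop) fun s hs => ?_, ?_⟩
    · rw [hF, Function.update_of_ne hs.2]
    · rwa [hF, continuousAt_update_same]
  refine ⟨dslope F p, (differentiableOn_dslope hR).2 hFd, fun s hs => ?_⟩
  have hs' : s - p ≠ 0 := sub_ne_zero.2 hs
  simp only
  rw [dslope_of_ne _ hs, slope_def_field, hF, Function.update_of_ne hs, Function.update_self]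
  field_simp
  ring

theorem rectBoundaryIntegral_of_simplePole {p w : ℂ} (ha : a < p.re) (hb : p.re < b)
    (hc : c < p.im) (hd : p.im < d)
    (hf : DifferentiableOn ℂ f ((Icc a b ×ℂ Icc c d) \ {p}))
    (hw : Tendsto (fun s => (s - p) * f s) (𝓝[≠] p) (𝓝 w)) :
    rectBoundaryIntegral f a b c d = 2 * π * I * w := by
  have hab : a ≤ b := (ha.trans hb).le
  have hcd : c ≤ d := (hc.trans hd).le
  have hR : Icc a b ×ℂ Icc c d ∈ 𝓝 p :=
    mem_of_superset ((isOpen_Ioo.reProdIm isOpen_Ioo).mem_nhds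
      (show p ∈ Ioo a b ×ℂ Ioo c d from ⟨⟨ha, hb⟩, hc, hd⟩))
      fun _ hs => ⟨Ioo_subset_Icc_self hs.1, Ioo_subset_Icc_self hs.2⟩
  obtain ⟨g, hg, hfg⟩ := exists_differentiableOn_eq_simplePole_add hR hf hw
  have hne (s : ℂ) (hs : s ∈ rectBoundary a b c d) : s ≠ p :=
    ne_of_mem_of_not_mem hs (notMem_rectBoundary ha hb hc hd)
  have hinv : ContinuousOn (fun s => (s - p)⁻¹) (rectBoundary a b c d) :=
    (by fun_prop : ContinuousOn (fun s => s - p) _).inv₀ fun s hs => sub_ne_zero.2 (hne s hs)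
  rw [rectBoundaryIntegral_congr hab hcd fun s hs => hfg (hne s hs),
    rectBoundaryIntegral_const_mul_add hab hcd hinv
      (hg.continuousOn.mono (rectBoundary_subset hab hcd)),
    rectBoundaryIntegral_inv_sub ha hb hc hd,
    rectBoundaryIntegral_eq_zero (by rwa [uIcc_of_le hab, uIcc_of_le hcd])]
  ring

theorem rectBoundaryIntegral_add_adjacent {b' : ℝ} (hab : a ≤ b) (hbb' : b ≤ b')
    (hf : ContinuousOn f (Icc a b' ×ℂ {c, d})) :
    rectBoundaryIntegral f a b c d + rectBoundaryIntegral f b b' c d =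
      rectBoundaryIntegral f a b' c d := by
  have horizontal (y : ℝ) (hy : y = c ∨ y = d) :
      (∫ x in a..b, f (x + y * I)) + (∫ x in b..b', f (x + y * I)) =
        ∫ x in a..b', f (x + y * I) := by
    have hcont : ContinuousOn (fun x : ℝ => f (x + y * I)) (Icc a b') :=
      hf.comp (by fun_prop) fun x hx => ⟨by simpa using hx, by simpa using hy⟩
    refine intervalIntegral.integral_add_adjacent_intervals
      (hcont.mono ?_).intervalIntegrable (hcont.mono ?_).intervalIntegrable
    · rw [uIcc_of_le hab]; exact Icc_subset_Icc_right hbb'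
    · rw [uIcc_of_le hbb']; exact Icc_subset_Icc_left hab
  simp only [rectBoundaryIntegral]
  linear_combination horizontal c (.inl rfl) - horizontal d (.inr rfl)

theorem tendsto_integral_vertical_zero {ι : Type*} {l : Filter ι} {x : ι → ℝ} {B : ι → ℝ}
    (hB : Tendsto B l (𝓝 0)) (hf : ∀ᶠ n in l, ∀ y ∈ uIcc c d, ‖f (x n + y * I)‖ ≤ B n) :
    Tendsto (fun n => ∫ y in c..d, f (x n + y * I)) l (𝓝 0) := by
  refine squeeze_zero_norm' ?_ (by simpa using hB.mul_const |d - c|)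
  filter_upwards [hf] with n hn
  exact intervalIntegral.norm_integral_le_of_norm_le_const fun y hy =>
    hn y (uIoc_subset_uIcc hy)

/-- The integral of `f` over the positively oriented boundary
`-∞ + ic → b + ic → b + id → -∞ + id` of the half-strip `(-∞, b] × [c, d]`. -/
noncomputable def halfStripBoundaryIntegral (f : ℂ → ℂ) (b c d : ℝ) : ℂ :=
  (∫ x in Iic b, f (x + c * I)) + I * (∫ y in c..d, f (b + y * I)) - ∫ x in Iic b, f (x + d * I)

theorem tendsto_rectBoundaryIntegral_halfStrip {ι : Type*} {l : Filter ι}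
    [l.IsCountablyGenerated] {x B : ι → ℝ}
    (hfc : IntegrableOn (fun x : ℝ => f (x + c * I)) (Iic b))
    (hfd : IntegrableOn (fun x : ℝ => f (x + d * I)) (Iic b))
    (hx : Tendsto x l atBot) (hB : Tendsto B l (𝓝 0))
    (hf : ∀ᶠ n in l, ∀ y ∈ uIcc c d, ‖f (x n + y * I)‖ ≤ B n) :
    Tendsto (fun n => rectBoundaryIntegral f (x n) b c d) l
      (𝓝 (halfStripBoundaryIntegral f b c d)) := by
  have h := (((intervalIntegral_tendsto_integral_Iic b hfc hx).sub
    (intervalIntegral_tendsto_integral_Iic b hfd hx)).add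
    (tendsto_const_nhds (x := I * ∫ y in c..d, f (b + y * I)))).sub
    ((tendsto_integral_vertical_zero hB hf).const_mul I)
  rw [mul_zero, sub_zero] at h
  rwa [halfStripBoundaryIntegral, add_sub_right_comm]

theorem halfStripBoundaryIntegral_eq_zero {B : ℝ → ℝ}
    (hdiff : DifferentiableOn ℂ f (Iic b ×ℂ uIcc c d))
    (hfc : IntegrableOn (fun x : ℝ => f (x + c * I)) (Iic b))
    (hfd : IntegrableOn (fun x : ℝ => f (x + d * I)) (Iic b))
    (hB : Tendsto B atBot (𝓝 0)) (hf : ∀ x : ℝ, ∀ y ∈ uIcc c d, ‖f (x + y * I)‖ ≤ B x) :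
    halfStripBoundaryIntegral f b c d = 0 := by
  refine tendsto_nhds_unique (tendsto_rectBoundaryIntegral_halfStrip hfc hfd tendsto_id hB
    (.of_forall hf)) (tendsto_const_nhds.congr' ?_)
  filter_upwards [eventually_le_atBot b] with x hx
  refine (rectBoundaryIntegral_eq_zero (hdiff.mono fun s hs => ⟨?_, hs.2⟩)).symm
  exact hs.1.2.trans (sup_le hx le_rfl)

theorem integral_horizontal_eq_integral_horizontal {B : ℝ → ℝ}
    (hdiff : DifferentiableOn ℂ f (im ⁻¹' uIcc c d))
    (hfc : Integrable fun x : ℝ => f (x + c * I)) (hfd : Integrable fun x : ℝ => f (x + d * I))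
    (hBbot : Tendsto B atBot (𝓝 0)) (hBtop : Tendsto B atTop (𝓝 0))
    (hf : ∀ x : ℝ, ∀ y ∈ uIcc c d, ‖f (x + y * I)‖ ≤ B x) :
    ∫ x : ℝ, f (x + c * I) = ∫ x : ℝ, f (x + d * I) := by
  have hzero (n : ℝ) : (∫ x in Iic n, f (x + c * I)) + I * (∫ y in c..d, f (n + y * I)) -
      ∫ x in Iic n, f (x + d * I) = 0 :=
    halfStripBoundaryIntegral_eq_zero (hdiff.mono fun s hs => hs.2) hfc.integrableOn
      hfd.integrableOn hBbot hf
  have hlim (y : ℝ) (hy : Integrable fun x : ℝ => f (x + y * I)) :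
      Tendsto (fun n : ℝ => ∫ x in Iic n, f (x + y * I)) atTop (𝓝 (∫ x : ℝ, f (x + y * I))) :=
    (aecover_Iic tendsto_id).integral_tendsto_of_countably_generated hy
  have h := ((hlim c hfc).add ((tendsto_integral_vertical_zero (x := id) (c := c) (d := d) hBtop
    (.of_forall hf)).const_mul I)).sub (hlim d hfd)
  simp only [id, hzero, mul_zero, add_zero] at h
  exact sub_eq_zero.1 (tendsto_nhds_unique h tendsto_const_nhds)

theorem rectBoundaryIntegral_eq_residue_neg_nat {r : ℂ} {k : ℕ} (ha : a ∈ Ioo (-k - 1 : ℝ) (-k))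
    (hb : -k < b) (hpole : ∀ j < k, b < -j) (hc : c < 0) (hd : 0 < d)
    (hf : DifferentiableOn ℂ f ((Icc a b ×ℂ Icc c d) \ range fun k : ℕ => -(k : ℂ)))
    (hr : Tendsto (fun s => (s + k) * f s) (𝓝[≠] (-k)) (𝓝 r)) :
    rectBoundaryIntegral f a b c d = 2 * π * I * r := by
  refine rectBoundaryIntegral_of_simplePole (p := -k) (by simpa using ha.2) (by simpa using hb)
    (by simpa using hc) (by simpa using hd) (hf.mono fun s hs => ⟨hs.1, ?_⟩) (by simpa using hr)
  obtain ⟨⟨⟨hre₁, hre₂⟩, -⟩, hsk⟩ := hs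
  rintro ⟨j, rfl⟩
  simp only [neg_re, natCast_re] at hre₁ hre₂
  rcases lt_trichotomy j k with hjk | rfl | hkj
  · exact (hpole j hjk).not_ge hre₂
  · exact hsk rfl
  · have : (k + 1 : ℝ) ≤ j := by exact_mod_cast hkj
    linarith [ha.1]

theorem rectBoundaryIntegral_eq_sum_residues {R : ℕ → ℂ} (hb : 0 < b) (hc : c < 0) (hd : 0 < d)
    (hf : DifferentiableOn ℂ f ((Iic b ×ℂ Icc c d) \ range fun k : ℕ => -(k : ℂ)))
    (hR : ∀ k : ℕ, Tendsto (fun s => (s + k) * f s) (𝓝[≠] (-k)) (𝓝 (R k))) (n : ℕ) :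
    rectBoundaryIntegral f (-n - 1 / 2) b c d = 2 * π * I * ∑ k ∈ Finset.range (n + 1), R k := by
  have hf_rect (a' b' : ℝ) (hb' : b' ≤ b) :
      DifferentiableOn ℂ f ((Icc a' b' ×ℂ Icc c d) \ range fun k : ℕ => -(k : ℂ)) :=
    hf.mono fun s hs => ⟨⟨hs.1.1.2.trans hb', hs.1.2⟩, hs.2⟩
  have hf_horizontal (a' : ℝ) : ContinuousOn f (Icc a' b ×ℂ {c, d}) := by
    refine hf.continuousOn.mono fun s ⟨hre, him⟩ => ⟨⟨hre.2, ?_⟩, ?_⟩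
    · exact pair_subset (left_mem_Icc.2 (hc.trans hd).le) (right_mem_Icc.2 (hc.trans hd).le) him
    · rintro ⟨j, rfl⟩
      rcases him with him | him
      exacts [hc.ne (by simpa using him.symm), hd.ne (by simpa using him)]
  induction n with
  | zero =>
    simpa using rectBoundaryIntegral_eq_residue_neg_nat (a := -(0 : ℕ) - 1 / 2) (by norm_num)
      (by simpa using hb) (by simp) hc hd (hf_rect _ _ le_rfl) (hR 0)
  | succ n ih =>
    have : (0 : ℝ) ≤ n := n.cast_nonneg
    have hpole (j : ℕ) (hj : j < n + 1) : (-n - 1 / 2 : ℝ) < -j := by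
      have : (j : ℝ) ≤ n := by exact_mod_cast Nat.lt_succ_iff.1 hj
      linarith
    rw [Finset.sum_range_succ, mul_add, ← ih,
      ← rectBoundaryIntegral_add_adjacent (b := -n - 1 / 2) (by push_cast; linarith)
        (by linarith) (hf_horizontal _),
      rectBoundaryIntegral_eq_residue_neg_nat (k := n + 1)
        ⟨by push_cast; linarith, by push_cast; linarith⟩ (by push_cast; linarith) hpole hc hd
        (hf_rect _ _ (by linarith)) (hR (n + 1)), add_comm]

theorem halfStripBoundaryIntegral_eq_of_hasSum_residues {R : ℕ → ℂ} {B : ℕ → ℝ} {w : ℂ}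
    (hb : 0 < b) (hc : c < 0) (hd : 0 < d)
    (hdiff : DifferentiableOn ℂ f ((Iic b ×ℂ Icc c d) \ range fun k : ℕ => -(k : ℂ)))
    (hR : ∀ k : ℕ, Tendsto (fun s => (s + k) * f s) (𝓝[≠] (-k)) (𝓝 (R k))) (hw : HasSum R w)
    (hfc : IntegrableOn (fun x : ℝ => f (x + c * I)) (Iic b))
    (hfd : IntegrableOn (fun x : ℝ => f (x + d * I)) (Iic b))
    (hB : Tendsto B atTop (𝓝 0))
    (hf : ∀ᶠ n : ℕ in atTop, ∀ y ∈ Icc c d, ‖f ((-n - 1 / 2 : ℝ) + y * I)‖ ≤ B n) :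
    halfStripBoundaryIntegral f b c d = 2 * π * I * w := by
  have hx : Tendsto (fun n : ℕ => (-n - 1 / 2 : ℝ)) atTop atBot :=
    tendsto_atBot_add_const_right _ _ (tendsto_neg_atTop_atBot.comp tendsto_natCast_atTop_atTop)
  rw [← uIcc_of_le (hc.trans hd).le] at hf
  refine tendsto_nhds_unique (tendsto_rectBoundaryIntegral_halfStrip hfc hfd hx hB hf) ?_
  simp only [rectBoundaryIntegral_eq_sum_residues hb hc hd hdiff hR]
  exact ((hw.tendsto_sum_nat.comp (tendsto_add_atTop_nat 1))).const_mul _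

end Rectangle

/-! ### Bounds for the Gamma function -/

section Gamma

theorem norm_Gamma_le_Gamma_re {s : ℂ} (hs : 0 < s.re) : ‖Gamma s‖ ≤ Real.Gamma s.re := by
  rw [Gamma_eq_integral hs, Real.Gamma_eq_integral hs, GammaIntegral]
  refine norm_integral_le_of_norm_le (Real.GammaIntegral_convergent hs) ?_
  filter_upwards [ae_restrict_mem measurableSet_Ioi] with x hx
  rw [norm_mul, norm_real, norm_cpow_eq_rpow_re_of_pos hx, Real.norm_of_nonneg (Real.exp_pos _).le]
  simp

theorem norm_betaIntegral_le {u v : ℂ} (hu : 0 < u.re) (hv : 1 ≤ v.re) :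
    ‖betaIntegral u v‖ ≤ 1 / u.re := by
  have hInt : ∫ x in (0 : ℝ)..1, x ^ (u.re - 1) = 1 / u.re := by
    rw [integral_rpow (Or.inl (by linarith))]
    simp [Real.zero_rpow hu.ne']
  rw [← hInt, betaIntegral]
  refine intervalIntegral.norm_integral_le_of_norm_le zero_le_one
    (.of_forall fun x hx => ?_) (intervalIntegral.intervalIntegrable_rpow' (by linarith))
  have hle : ‖(1 - (x : ℂ)) ^ (v - 1)‖ ≤ 1 := by
    rcases hx.2.lt_or_eq with hx1 | rfl
    · rw [← ofReal_one, ← ofReal_sub, norm_cpow_eq_rpow_re_of_pos (sub_pos.2 hx1)]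
      exact Real.rpow_le_one (sub_pos.2 hx1).le (by linarith [hx.1]) (by simpa using hv)
    · rcases eq_or_ne (v - 1) 0 with h0 | h0 <;> simp [h0]
  rw [norm_mul, norm_cpow_eq_rpow_re_of_pos hx.1, sub_re, one_re]
  exact mul_le_of_le_one_right (Real.rpow_nonneg hx.1.le _) hle

-- With `u = Re s - 1` and `v = 1 + i Im s` this is the bound `|B(u, v)| ≤ 1 / u`.
theorem Gamma_re_mul_norm_Gamma_le {s : ℂ} (hs : 1 < s.re) :
    Real.Gamma s.re * ‖Gamma (1 + s.im * I)‖ ≤ ‖Gamma s‖ := by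
  obtain ⟨u, hu⟩ : ∃ u, u = s.re - 1 := ⟨_, rfl⟩
  have hu0 : 0 < u := by linarith
  have hsum : (u : ℂ) + (1 + s.im * I) = s := by apply Complex.ext <;> simp [hu]
  have hbeta : ‖betaIntegral u (1 + s.im * I)‖ ≤ 1 / u := by
    simpa using norm_betaIntegral_le (u := u) (v := 1 + s.im * I) (by simpa using hu0) (by simp)
  have hprod := congrArg norm (Gamma_mul_Gamma_eq_betaIntegral (s := u) (t := 1 + s.im * I)
    (by simpa using hu0) (by simp))
  rw [hsum, norm_mul, norm_mul, Gamma_ofReal, norm_real,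
    Real.norm_of_nonneg (Real.Gamma_pos_of_pos hu0).le] at hprod
  calc Real.Gamma s.re * ‖Gamma (1 + s.im * I)‖
      = u * (Real.Gamma u * ‖Gamma (1 + s.im * I)‖) := by
        rw [← mul_assoc, ← Real.Gamma_add_one hu0.ne', hu, sub_add_cancel]
    _ ≤ u * (‖Gamma s‖ * (1 / u)) := by rw [hprod]; gcongr
    _ = ‖Gamma s‖ := by field_simp

theorem rpow_mul_exp_neg_le_Gamma {x B : ℝ} (hx : 1 ≤ x) (hB : 0 < B) :
    B ^ (x - 1) * Real.exp (-B) ≤ Real.Gamma x := by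
  have hx0 : 0 < x := by linarith
  have hInt := Real.GammaIntegral_convergent hx0
  have hsub : Ioi B ⊆ Ioi (0 : ℝ) := Ioi_subset_Ioi hB.le
  calc B ^ (x - 1) * Real.exp (-B) = ∫ t in Ioi B, B ^ (x - 1) * Real.exp (-t) := by
        rw [integral_const_mul, integral_exp_neg_Ioi]
    _ ≤ ∫ t in Ioi B, Real.exp (-t) * t ^ (x - 1) := by
        refine setIntegral_mono_on ((integrableOn_exp_neg_Ioi B).const_mul _)
          (hInt.mono_set hsub) measurableSet_Ioi fun t ht => ?_
        rw [mul_comm]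
        gcongr
        exact le_of_lt ht
    _ ≤ ∫ t in Ioi 0, Real.exp (-t) * t ^ (x - 1) := by
        refine setIntegral_mono_set hInt ?_ hsub.eventuallyLE
        filter_upwards [ae_restrict_mem measurableSet_Ioi] with t ht
        exact mul_nonneg (Real.exp_pos _).le (Real.rpow_nonneg (le_of_lt ht) _)
    _ = Real.Gamma x := (Real.Gamma_eq_integral hx0).symm

theorem rpow_le_mul_exp {a b t : ℝ} (ha : 0 < a) (hb : 0 < b) (ht : 0 < t) :
    t ^ a ≤ (a / b) ^ a * Real.exp (b * t) := by
  have hle : b * t / a ≤ Real.exp (b * t / a) := by linarith [Real.add_one_le_exp (b * t / a)]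
  calc t ^ a = (a / b) ^ a * (b * t / a) ^ a := by
        rw [← Real.mul_rpow (by positivity) (by positivity)]
        field_simp
    _ ≤ (a / b) ^ a * Real.exp (b * t / a) ^ a := by gcongr
    _ = (a / b) ^ a * Real.exp (b * t) := by
        rw [← Real.exp_mul, div_mul_cancel₀ _ ha.ne']

theorem Gamma_add_le {a x : ℝ} (ha : 0 < a) (hx : 0 < x) :
    Real.Gamma (a + x) ≤ (2 * a) ^ a * 2 ^ x * Real.Gamma x := by
  have hax : 0 < a + x := by linarith
  have hscaled := Real.integral_rpow_mul_exp_neg_mul_Ioi hx (r := 1 / 2) (by norm_num)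
  rw [one_div_one_div] at hscaled
  have hInt : IntegrableOn (fun t : ℝ => t ^ (x - 1) * Real.exp (-(1 / 2 * t))) (Ioi 0) := by
    simpa using integrableOn_rpow_mul_exp_neg_mul_rpow (s := x - 1) (p := 1) (b := 1 / 2)
      (by linarith) one_pos (by norm_num)
  rw [Real.Gamma_eq_integral hax, mul_assoc, ← hscaled, ← integral_const_mul]
  refine setIntegral_mono_on (Real.GammaIntegral_convergent hax)
    (hInt.const_mul _) measurableSet_Ioi fun t (ht : 0 < t) => ?_
  calc Real.exp (-t) * t ^ (a + x - 1) = t ^ a * (t ^ (x - 1) * Real.exp (-t)) := by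
        rw [add_sub_assoc, Real.rpow_add ht]; ring
    _ ≤ (a / (1 / 2)) ^ a * Real.exp (1 / 2 * t) * (t ^ (x - 1) * Real.exp (-t)) := by
        gcongr; exact rpow_le_mul_exp ha (by norm_num) ht
    _ = (2 * a) ^ a * (t ^ (x - 1) * (Real.exp (1 / 2 * t) * Real.exp (-t))) := by
        rw [div_div_eq_mul_div, div_one, mul_comm a]; ring
    _ = (2 * a) ^ a * (t ^ (x - 1) * Real.exp (-(1 / 2 * t))) := by
        rw [← Real.exp_add]; ring_nf

theorem differentiableAt_Gamma_of_re_pos {s : ℂ} (hs : 0 < s.re) : DifferentiableAt ℂ Gamma s :=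
  differentiableAt_Gamma _ fun m h => by
    rw [h, neg_re, natCast_re] at hs
    linarith [m.cast_nonneg (α := ℝ)]

theorem exists_pos_le_norm_Gamma_one_add_mul_I (Y : ℝ) :
    ∃ m > 0, ∀ y : ℝ, |y| ≤ Y → m ≤ ‖Gamma (1 + y * I)‖ := by
  rcases lt_or_ge Y 0 with hY | hY
  · exact ⟨1, one_pos, fun y hy => absurd (hy.trans_lt hY) (abs_nonneg y).not_gt⟩
  have hre (y : ℝ) : 0 < (1 + y * I : ℂ).re := by simp
  have hcont : Continuous fun y : ℝ => ‖Gamma (1 + y * I)‖ :=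
    (continuous_iff_continuousAt.2 fun y => ContinuousAt.comp (f := fun y : ℝ => (1 + y * I : ℂ))
      (differentiableAt_Gamma_of_re_pos (hre y)).continuousAt (by fun_prop)).norm
  obtain ⟨y₀, -, hmin⟩ := (isCompact_Icc (a := -Y) (b := Y)).exists_isMinOn
    ⟨0, by simp [hY]⟩ hcont.continuousOn
  exact ⟨_, norm_pos_iff.2 (Gamma_ne_zero_of_re_pos (hre y₀)), fun y hy => hmin (abs_le.1 hy)⟩

theorem exists_Gamma_re_le_mul_norm_Gamma (Y : ℝ) :
    ∃ C > 0, ∀ s : ℂ, 1 < s.re → |s.im| ≤ Y → Real.Gamma s.re ≤ C * ‖Gamma s‖ := by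
  obtain ⟨m, hm, hle⟩ := exists_pos_le_norm_Gamma_one_add_mul_I Y
  refine ⟨m⁻¹, by positivity, fun s hs hY => ?_⟩
  have hΓ : 0 ≤ Real.Gamma s.re := (Real.Gamma_pos_of_pos (by linarith)).le
  rw [inv_mul_eq_div, le_div_iff₀ hm]
  exact (mul_le_mul_of_nonneg_left (hle _ hY) hΓ).trans (Gamma_re_mul_norm_Gamma_le hs)

theorem exists_norm_Gamma_add_le {a : ℝ} (ha : 0 < a) (Y : ℝ) :
    ∃ C > 0, ∀ s : ℂ, 1 ≤ s.re → |s.im| ≤ Y →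
      ‖Gamma (a + s)‖ ≤ C * 2 ^ s.re * ‖Gamma (1 + s)‖ := by
  obtain ⟨C, hC, hle⟩ := exists_Gamma_re_le_mul_norm_Gamma Y
  refine ⟨(2 * a) ^ a * C, by positivity, fun s hs hY => ?_⟩
  have hs0 : 0 < s.re := by linarith
  have hΓ : Real.Gamma s.re ≤ C * ‖Gamma (1 + s)‖ := by
    have h := hle (1 + s) (by simpa using hs0) (by simpa using hY)
    rw [add_re, one_re, add_comm 1 s.re, Real.Gamma_add_one hs0.ne'] at h
    exact (le_mul_of_one_le_left (Real.Gamma_pos_of_pos hs0).le hs).trans h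
  calc ‖Gamma (a + s)‖ ≤ Real.Gamma (a + s.re) := by
        simpa using norm_Gamma_le_Gamma_re (s := a + s) (by simpa using by linarith)
    _ ≤ (2 * a) ^ a * 2 ^ s.re * Real.Gamma s.re := Gamma_add_le ha hs0
    _ ≤ (2 * a) ^ a * 2 ^ s.re * (C * ‖Gamma (1 + s)‖) := by gcongr
    _ = (2 * a) ^ a * C * 2 ^ s.re * ‖Gamma (1 + s)‖ := by ring

theorem exists_norm_inv_Gamma_le (Y b : ℝ) :
    ∃ C > 0, ∀ s : ℂ, 1 < s.re → |s.im| ≤ Y → ‖(Gamma s)⁻¹‖ ≤ C * Real.exp (-b * s.re) := by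
  obtain ⟨C, hC, hle⟩ := exists_Gamma_re_le_mul_norm_Gamma Y
  refine ⟨C * Real.exp (b + Real.exp b), by positivity, fun s hs hY => ?_⟩
  have hpos : 0 < ‖Gamma s‖ := norm_pos_iff.2 (Gamma_ne_zero_of_re_pos (by linarith))
  have hΓ : Real.exp (b * (s.re - 1) - Real.exp b) ≤ C * ‖Gamma s‖ := by
    rw [sub_eq_add_neg, Real.exp_add, Real.exp_mul]
    exact (rpow_mul_exp_neg_le_Gamma hs.le (Real.exp_pos b)).trans (hle s hs hY)
  rw [norm_inv, inv_le_iff_one_le_mul₀' hpos]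
  calc 1 = Real.exp (b * (s.re - 1) - Real.exp b) * Real.exp (b + Real.exp b + -b * s.re) := by
        rw [← Real.exp_add]; ring_nf; simp
    _ ≤ C * ‖Gamma s‖ * Real.exp (b + Real.exp b + -b * s.re) := by gcongr
    _ = ‖Gamma s‖ * (C * Real.exp (b + Real.exp b) * Real.exp (-b * s.re)) := by
        rw [Real.exp_add]; ring

theorem norm_Gamma_eq_pi_div {s : ℂ} (hs : s.re < 1) :
    ‖Gamma s‖ = π / ‖sin (π * s)‖ * ‖Gamma (1 - s)‖⁻¹ := by
  have hne : Gamma (1 - s) ≠ 0 := Gamma_ne_zero_of_re_pos (by simpa using hs)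
  rw [← div_eq_mul_inv, eq_div_iff (norm_ne_zero_iff.2 hne), ← norm_mul, Gamma_mul_Gamma_one_sub,
    norm_div, norm_real, Real.norm_of_nonneg Real.pi_pos.le]

theorem norm_cpow_neg_le {z s : ℂ} {Y : ℝ} (hz : z ≠ 0) (hs : s.re ≤ 0) (hY : |s.im| ≤ Y) :
    ‖z ^ (-s)‖ ≤ Real.exp (π * Y) * Real.exp (|Real.log ‖z‖| * -s.re) := by
  have hre : Real.log ‖z‖ * -s.re ≤ |Real.log ‖z‖| * -s.re :=
    mul_le_mul_of_nonneg_right (le_abs_self _) (by linarith)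
  have him : z.arg * s.im ≤ π * Y :=
    calc z.arg * s.im ≤ |z.arg| * |s.im| := (le_abs_self _).trans_eq (abs_mul _ _)
      _ ≤ π * Y := by gcongr; exact abs_arg_le_pi z
  rw [norm_cpow_of_ne_zero hz, Real.rpow_def_of_pos (norm_pos_iff.2 hz), ← Real.exp_sub,
    ← Real.exp_add, Real.exp_le_exp, neg_re, neg_im]
  linarith

theorem norm_sin_sq (z : ℂ) : ‖sin z‖ ^ 2 = Real.sin z.re ^ 2 + Real.sinh z.im ^ 2 := by
  rw [sin_eq, ← normSq_eq_norm_sq]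
  simp only [← ofReal_sin, ← ofReal_cos, ← ofReal_sinh, ← ofReal_cosh, ← ofReal_mul]
  rw [normSq_add_mul_I, mul_pow, mul_pow, Real.cosh_sq]
  linear_combination Real.sinh z.im ^ 2 * Real.sin_sq_add_cos_sq z.re

theorem abs_sinh_im_le_norm_sin (z : ℂ) : |Real.sinh z.im| ≤ ‖sin z‖ :=
  abs_le_of_sq_le_sq (by rw [norm_sin_sq]; linarith [sq_nonneg (Real.sin z.re)]) (norm_nonneg _)

theorem abs_sin_re_le_norm_sin (z : ℂ) : |Real.sin z.re| ≤ ‖sin z‖ :=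
  abs_le_of_sq_le_sq (by rw [norm_sin_sq]; linarith [sq_nonneg (Real.sinh z.im)]) (norm_nonneg _)

theorem tendsto_add_nat_mul_Gamma_nhdsNE_neg_nat (k : ℕ) :
    Tendsto (fun s : ℂ => (s + k) * Gamma s) (𝓝[≠] (-k)) (𝓝 ((-1) ^ k / (k.factorial : ℂ))) := by
  induction k with
  | zero => simpa using tendsto_self_mul_Gamma_nhds_zero
  | succ k ih =>
    have hk : -((k + 1 : ℕ) : ℂ) ≠ 0 := neg_ne_zero.2 (Nat.cast_ne_zero.2 k.succ_ne_zero)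
    have hshift : Tendsto (fun s : ℂ => s + 1) (𝓝[≠] (-((k + 1 : ℕ) : ℂ))) (𝓝[≠] (-(k : ℂ))) := by
      have hval : -((k + 1 : ℕ) : ℂ) + 1 = -k := by push_cast; ring
      rw [← hval]
      exact (by fun_prop : ContinuousWithinAt (fun s : ℂ => s + 1) _ _).tendsto_nhdsWithin
        fun s hs h => hs (add_right_cancel h)
    have hquot := (ih.comp hshift).div (continuousWithinAt_id (s := {-((k + 1 : ℕ) : ℂ)}ᶜ)) hk
    have hlim : (-1) ^ k / (k.factorial : ℂ) / id (-((k + 1 : ℕ) : ℂ)) =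
        (-1) ^ (k + 1) / ((k + 1).factorial : ℂ) := by
      rw [id, Nat.factorial_succ, Nat.cast_mul, pow_succ, div_neg, div_div, mul_comm, mul_neg_one,
        neg_div]
    rw [hlim] at hquot
    refine hquot.congr' ?_
    filter_upwards [nhdsWithin_le_nhds (isOpen_ne.mem_nhds hk)] with s (hs : s ≠ 0)
    rw [Pi.div_apply, Function.comp_apply, id, Gamma_add_one s hs]
    push_cast
    field_simp
    ring

end Gamma

/-! ### The Fox function as a residue series -/

section Fox

variable {β ρ : ℝ} {z : ℂ}

/-- The residue at `s = -k` of the Mellin-Barnes integrand of `laplaceFoxParams β ρ`, i.e. the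
`k`-th term of the power series of the Fox function. -/
noncomputable def laplaceFoxTerm (β ρ : ℝ) (z : ℂ) (k : ℕ) : ℂ :=
  (-z) ^ k * Gamma (ρ + k) / (k.factorial * Gamma (1 - β + β * ρ + β * k))

/-- The factor of the Mellin-Barnes integrand of `laplaceFoxParams β ρ` other than `Γ(s)`; it is
holomorphic on `Re s < ρ`. -/
noncomputable def laplaceFoxCofactor (β ρ : ℝ) (z s : ℂ) : ℂ :=
  Gamma (ρ - s) * (Gamma (1 - β + β * ρ - β * s))⁻¹ * z ^ (-s)

theorem laplaceFoxParams_valid (hβ : 0 < β) (ρ : ℝ) : (laplaceFoxParams β ρ).Valid := by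
  refine ⟨le_rfl, le_rfl, by norm_num, fun j => ?_, fun j => ?_, ?_⟩
  · fin_cases j; simp [laplaceFoxParams]
  · fin_cases j <;> simp [laplaceFoxParams, hβ]
  · simp [laplaceFoxParams, hβ]

theorem laplaceFoxParams_integrand (β ρ : ℝ) (z s : ℂ) :
    (laplaceFoxParams β ρ).integrand z s = Gamma s * laplaceFoxCofactor β ρ z s := by
  have hlt₂ : (Finset.univ.filter fun j : Fin 2 => (j : ℕ) < 1) = {0} := by decide
  have hge₂ : (Finset.univ.filter fun j : Fin 2 => 1 ≤ (j : ℕ)) = {1} := by decide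
  have hlt₁ : (Finset.univ.filter fun j : Fin 1 => (j : ℕ) < 1) = {0} := by decide
  have hge₁ : (Finset.univ.filter fun j : Fin 1 => 1 ≤ (j : ℕ)) = ∅ := by decide
  have harg : 1 - (β : ℂ) * (1 - ρ) - s * β = 1 - (β : ℂ) + β * ρ - β * s := by ring
  rw [FoxParams.integrand, FoxParams.theta, hlt₂, hge₂, hlt₁, hge₁]
  simp [laplaceFoxParams, laplaceFoxCofactor, div_eq_mul_inv, harg, mul_assoc]

theorem laplaceFoxParams_isLoop_iff {γ φ₁ φ₂ : ℝ} :
    (laplaceFoxParams β ρ).IsLoop γ φ₁ φ₂ ↔ 0 < γ ∧ γ < ρ ∧ φ₁ < 0 ∧ 0 < φ₂ := by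
  constructor
  · rintro ⟨-, hinside, houtside⟩
    have hzero := hinside 0 (by norm_num) 0 0 (by simp [laplaceFoxParams])
    have hρ := houtside 0 (by norm_num) 0 ρ (by simp [laplaceFoxParams])
    simp only [zero_re, zero_im] at hzero
    refine ⟨hzero.1, ?_, hzero.2⟩
    by_contra hγ
    exact hρ ⟨by simpa using hγ, by simpa using hzero.2.1.le, by simpa using hzero.2.2.le⟩
  · rintro ⟨hγ, hγρ, hφ₁, hφ₂⟩
    refine ⟨hφ₁.trans hφ₂, fun j hj k s hs => ?_, fun j hj k s hs hle => ?_⟩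
    · obtain rfl : j = 0 := Fin.ext (by simpa using hj)
      obtain rfl : s = -k := by simpa [laplaceFoxParams] using hs
      simpa [hφ₁, hφ₂] using by linarith [k.cast_nonneg (α := ℝ)]
    · obtain rfl : j = 0 := Subsingleton.elim _ _
      have hre : ρ - s.re = -k := by simpa [laplaceFoxParams] using congrArg re hs
      linarith [hle.1, k.cast_nonneg (α := ℝ)]

theorem differentiableAt_laplaceFoxCofactor (β : ℝ) (hz : z ≠ 0) {s : ℂ} (hs : s.re < ρ) :
    DifferentiableAt ℂ (laplaceFoxCofactor β ρ z) s := by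
  refine (DifferentiableAt.mul ?_ ?_).mul ?_
  · exact DifferentiableAt.comp s (differentiableAt_Gamma_of_re_pos (by simpa using hs))
      (by fun_prop)
  · exact DifferentiableAt.comp s (f := fun s : ℂ => 1 - (β : ℂ) + β * ρ - β * s)
      (differentiable_one_div_Gamma _) (by fun_prop)
  · exact (by fun_prop : DifferentiableAt ℂ (fun s : ℂ => -s) s).const_cpow (Or.inl hz)

theorem differentiableAt_laplaceFoxParams_integrand (β : ℝ) (hz : z ≠ 0) {s : ℂ} (hs : s.re < ρ)
    (hpole : ∀ k : ℕ, s ≠ -k) : DifferentiableAt ℂ ((laplaceFoxParams β ρ).integrand z) s := by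
  rw [funext (laplaceFoxParams_integrand β ρ z)]
  exact (differentiableAt_Gamma _ hpole).mul (differentiableAt_laplaceFoxCofactor β hz hs)

theorem laplaceFoxCofactor_neg_nat (β ρ : ℝ) (z : ℂ) (k : ℕ) :
    (-1) ^ k / (k.factorial : ℂ) * laplaceFoxCofactor β ρ z (-k) = laplaceFoxTerm β ρ z k := by
  rw [laplaceFoxTerm, laplaceFoxCofactor, neg_neg, cpow_natCast, neg_pow z, sub_neg_eq_add,
    mul_neg, sub_neg_eq_add, div_eq_mul_inv, div_eq_mul_inv, mul_inv]
  ring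

theorem tendsto_residue_laplaceFoxParams_integrand (β : ℝ) (hρ : 0 < ρ) (hz : z ≠ 0) (k : ℕ) :
    Tendsto (fun s : ℂ => (s + k) * (laplaceFoxParams β ρ).integrand z s)
      (𝓝[≠] (-k)) (𝓝 (laplaceFoxTerm β ρ z k)) := by
  have hcofactor : DifferentiableAt ℂ (laplaceFoxCofactor β ρ z) (-k) :=
    differentiableAt_laplaceFoxCofactor β hz <| by
      simpa using by linarith [k.cast_nonneg (α := ℝ)]
  simp only [laplaceFoxParams_integrand, ← mul_assoc, ← laplaceFoxCofactor_neg_nat]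
  exact (tendsto_add_nat_mul_Gamma_nhdsNE_neg_nat k).mul
    (hcofactor.continuousAt.tendsto.mono_left nhdsWithin_le_nhds)

theorem exists_norm_laplaceFoxParams_integrand_le (hβ : 0 < β) (hρ : 0 < ρ) (hz : z ≠ 0) (Y : ℝ) :
    ∃ C > 0, ∀ s : ℂ, s.re ≤ -1 → |s.im| ≤ Y →
      ‖(laplaceFoxParams β ρ).integrand z s‖ ≤ C / ‖sin (π * s)‖ * Real.exp s.re := by
  set L := |Real.log ‖z‖|
  set b := (1 + L + Real.log 2) / β with hb
  obtain ⟨C₁, hC₁, hquot⟩ := exists_norm_Gamma_add_le hρ Y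
  obtain ⟨C₂, hC₂, hinv⟩ := exists_norm_inv_Gamma_le (β * Y) b
  refine ⟨π * C₁ * C₂ * Real.exp (π * Y) * Real.exp (-b * (1 - β + β * ρ)), by positivity,
    fun s hre him => ?_⟩
  have hΓ : 0 < ‖Gamma (1 - s)‖ :=
    norm_pos_iff.2 (Gamma_ne_zero_of_re_pos (by simpa using by linarith))
  have hquot_s : ‖Gamma (ρ - s)‖ ≤ C₁ * 2 ^ (-s.re) * ‖Gamma (1 - s)‖ := by
    simpa [← sub_eq_add_neg] using hquot (-s) (by simpa using by linarith) (by simpa using him)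
  have hinv_s : ‖(Gamma (1 - β + β * ρ - β * s))⁻¹‖ ≤
      C₂ * Real.exp (-b * (1 - β + β * ρ - β * s.re)) := by
    have hre' : 1 < 1 - β + β * ρ - β * s.re := by nlinarith [mul_pos hβ hρ]
    simpa using hinv (1 - β + β * ρ - β * s) (by simpa using hre')
      (by simpa [abs_mul, abs_of_pos hβ] using mul_le_mul_of_nonneg_left him hβ.le)
  have hexp : (2 : ℝ) ^ (-s.re) * Real.exp (-b * (1 - β + β * ρ - β * s.re)) *
      Real.exp (L * -s.re) = Real.exp (-b * (1 - β + β * ρ)) * Real.exp s.re := by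
    have hbβ : b * β = 1 + L + Real.log 2 := by rw [hb]; field_simp
    rw [Real.rpow_def_of_pos two_pos, ← Real.exp_add, ← Real.exp_add, ← Real.exp_add]
    congr 1
    linear_combination s.re * hbβ
  rw [laplaceFoxParams_integrand, laplaceFoxCofactor, norm_mul, norm_mul, norm_mul,
    norm_Gamma_eq_pi_div (by linarith)]
  calc π / ‖sin (π * s)‖ * ‖Gamma (1 - s)‖⁻¹ * (‖Gamma (ρ - s)‖ *
        ‖(Gamma (1 - (β : ℂ) + β * ρ - β * s))⁻¹‖ * ‖z ^ (-s)‖)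
      ≤ π / ‖sin (π * s)‖ * ‖Gamma (1 - s)‖⁻¹ * (C₁ * 2 ^ (-s.re) * ‖Gamma (1 - s)‖ *
        (C₂ * Real.exp (-b * (1 - β + β * ρ - β * s.re))) *
        (Real.exp (π * Y) * Real.exp (L * -s.re))) := by
        gcongr
        exact norm_cpow_neg_le hz (by linarith) him
    _ = π * C₁ * C₂ * Real.exp (π * Y) / ‖sin (π * s)‖ * (2 ^ (-s.re) *
        Real.exp (-b * (1 - β + β * ρ - β * s.re)) * Real.exp (L * -s.re)) := by
        field_simp
    _ = _ := by rw [hexp]; ring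

theorem integrableOn_Iic_of_norm_le_exp {f : ℝ → ℂ} {a b C : ℝ}
    (hf : ContinuousOn f (Iic b)) (hC : ∀ x ≤ a, ‖f x‖ ≤ C * Real.exp x) :
    IntegrableOn f (Iic b) := by
  have htail : IntegrableOn f (Iic (min a b)) := by
    refine Integrable.mono' (g := fun x => C * Real.exp x)
      ((integrableOn_exp_Iic _).const_mul C) ?_ ?_
    · exact (hf.mono (Iic_subset_Iic.2 (min_le_right _ _))).aestronglyMeasurable measurableSet_Iic
    · filter_upwards [ae_restrict_mem measurableSet_Iic] with x hx
      exact hC x (hx.trans (min_le_left _ _))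
  rw [← Iic_union_Icc_eq_Iic (min_le_right a b)]
  exact htail.union (hf.mono Icc_subset_Iic_self).integrableOn_Icc

theorem integrableOn_horizontal_laplaceFoxParams_integrand (hβ : 0 < β) (hρ : 0 < ρ) (hz : z ≠ 0)
    {γ y : ℝ} (hγ : γ < ρ) (hy : y ≠ 0) :
    IntegrableOn (fun x : ℝ => (laplaceFoxParams β ρ).integrand z (x + y * I)) (Iic γ) := by
  obtain ⟨C, hC, hle⟩ := exists_norm_laplaceFoxParams_integrand_le hβ hρ hz |y|
  refine integrableOn_Iic_of_norm_le_exp (a := -1) (C := C / |Real.sinh (π * y)|)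
    (fun x hx => ContinuousAt.continuousWithinAt ?_) fun x hx => ?_
  · refine ContinuousAt.comp (f := fun x : ℝ => (x + y * I : ℂ))
      (differentiableAt_laplaceFoxParams_integrand β hz ?_ fun k h => hy ?_).continuousAt
      (by fun_prop)
    · simpa using lt_of_le_of_lt hx hγ
    · simpa using congrArg im h
  · have : 0 < |Real.sinh (π * y)| :=
      abs_pos.2 (Real.sinh_eq_zero.not.2 (mul_ne_zero Real.pi_ne_zero hy))
    have hsin : |Real.sinh (π * y)| ≤ ‖sin (π * (x + y * I))‖ := by
      simpa using abs_sinh_im_le_norm_sin (π * (x + y * I))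
    calc ‖(laplaceFoxParams β ρ).integrand z (x + y * I)‖
        ≤ C / ‖sin (π * (x + y * I))‖ * Real.exp x := by
          simpa using hle (x + y * I) (by simpa using hx) (by simp)
      _ ≤ C / |Real.sinh (π * y)| * Real.exp x := by gcongr

theorem continuous_vertical_laplaceFoxParams_integrand (β : ℝ) (hz : z ≠ 0) {γ : ℝ} (hγ : 0 < γ)
    (hγρ : γ < ρ) : Continuous fun y : ℝ => (laplaceFoxParams β ρ).integrand z (γ + y * I) := by
  refine continuous_iff_continuousAt.2 fun y => ContinuousAt.comp
    (f := fun y : ℝ => (γ + y * I : ℂ)) (differentiableAt_laplaceFoxParams_integrand β hz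
      (by simpa using hγρ) fun k h => ?_).continuousAt (by fun_prop)
  have hre : γ = -k := by simpa using congrArg re h
  linarith [k.cast_nonneg (α := ℝ)]

theorem one_le_norm_sin_pi_mul_neg_nat_sub_half (n : ℕ) (y : ℝ) :
    1 ≤ ‖sin (π * ((-n - 1 / 2 : ℝ) + y * I))‖ := by
  have hre : (π * ((-n - 1 / 2 : ℝ) + y * I) : ℂ).re = -(π / 2 + n * π) := by
    rw [re_ofReal_mul, add_re, ofReal_re, re_ofReal_mul, I_re]
    ring
  have h := abs_sin_re_le_norm_sin (π * ((-n - 1 / 2 : ℝ) + y * I))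
  rwa [hre, Real.sin_neg, Real.sin_add_nat_mul_pi, Real.sin_pi_div_two, mul_one, abs_neg,
    abs_neg_one_pow] at h

theorem eventually_norm_laplaceFoxParams_integrand_le (hβ : 0 < β) (hρ : 0 < ρ) (hz : z ≠ 0)
    (c d : ℝ) : ∃ C : ℝ, ∀ᶠ n : ℕ in atTop, ∀ y ∈ Icc c d,
      ‖(laplaceFoxParams β ρ).integrand z ((-n - 1 / 2 : ℝ) + y * I)‖ ≤
        C * Real.exp (-n - 1 / 2) := by
  obtain ⟨C, hC, hle⟩ := exists_norm_laplaceFoxParams_integrand_le hβ hρ hz (max |c| |d|)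
  refine ⟨C, ?_⟩
  filter_upwards [eventually_ge_atTop 1] with n hn y hy
  have hn' : (1 : ℝ) ≤ n := by exact_mod_cast hn
  have h := hle ((-n - 1 / 2 : ℝ) + y * I) (by simp; linarith)
    (by simpa using abs_le_max_abs_abs hy.1 hy.2)
  rw [add_re, ofReal_re, re_ofReal_mul, I_re, mul_zero, add_zero] at h
  refine h.trans ?_
  gcongr
  exact div_le_self hC.le (one_le_norm_sin_pi_mul_neg_nat_sub_half n y)

theorem laplaceFoxParams_loopIntegral (hβ : 0 < β) (hρ : 0 < ρ) (hz : z ≠ 0) {w : ℂ}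
    (hw : HasSum (laplaceFoxTerm β ρ z) w) {γ φ₁ φ₂ : ℝ} (hγ : 0 < γ) (hγρ : γ < ρ) (hφ₁ : φ₁ < 0)
    (hφ₂ : 0 < φ₂) : (laplaceFoxParams β ρ).loopIntegral z γ φ₁ φ₂ = w := by
  obtain ⟨C, hC⟩ := eventually_norm_laplaceFoxParams_integrand_le hβ hρ hz φ₁ φ₂
  have hdiff : DifferentiableOn ℂ ((laplaceFoxParams β ρ).integrand z)
      ((Iic γ ×ℂ Icc φ₁ φ₂) \ range fun k : ℕ => -(k : ℂ)) := fun s hs =>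
    (differentiableAt_laplaceFoxParams_integrand β hz (lt_of_le_of_lt hs.1.1 hγρ)
      fun k h => hs.2 ⟨k, h.symm⟩).differentiableWithinAt
  have hdecay : Tendsto (fun n : ℕ => C * Real.exp (-n - 1 / 2)) atTop (𝓝 0) := by
    simpa [sub_eq_add_neg] using (Real.tendsto_exp_atBot.comp
      (tendsto_atBot_add_const_right _ (-(1 / 2) : ℝ)
      (tendsto_neg_atTop_atBot.comp tendsto_natCast_atTop_atTop))).const_mul C
  have hresidues := halfStripBoundaryIntegral_eq_of_hasSum_residues hγ hφ₁ hφ₂ hdiff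
    (tendsto_residue_laplaceFoxParams_integrand β hρ hz) hw
    (integrableOn_horizontal_laplaceFoxParams_integrand hβ hρ hz hγρ hφ₁.ne)
    (integrableOn_horizontal_laplaceFoxParams_integrand hβ hρ hz hγρ hφ₂.ne') hdecay hC
  rw [FoxParams.loopIntegral, one_div, inv_mul_eq_iff_eq_mul₀ two_pi_I_ne_zero]
  exact hresidues

theorem laplaceFoxParams_hasContourValue (hβ : 0 < β) (hρ : 0 < ρ) (hz : z ≠ 0) {w : ℂ}
    (hw : HasSum (laplaceFoxTerm β ρ z) w) : (laplaceFoxParams β ρ).HasContourValue z w := by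
  refine ⟨⟨ρ / 2, -1, 1, laplaceFoxParams_isLoop_iff.2 ⟨by linarith, by linarith, by norm_num,
    by norm_num⟩⟩, fun γ φ₁ φ₂ hloop => ?_⟩
  obtain ⟨hγ, hγρ, hφ₁, hφ₂⟩ := laplaceFoxParams_isLoop_iff.1 hloop
  exact ⟨⟨integrableOn_horizontal_laplaceFoxParams_integrand hβ hρ hz hγρ hφ₁.ne,
    (continuous_vertical_laplaceFoxParams_integrand β hz hγ hγρ).intervalIntegrable _ _,
    integrableOn_horizontal_laplaceFoxParams_integrand hβ hρ hz hγρ hφ₂.ne'⟩,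
    laplaceFoxParams_loopIntegral hβ hρ hz hw hγ hγρ hφ₁ hφ₂⟩

end Fox

/-! ### The Euler integral in logarithmic coordinates -/

section Euler

variable {s b θ : ℝ}

theorem integral_Ioi_zero_eq_integral_exp {E : Type*} [NormedAddCommGroup E] [NormedSpace ℝ E]
    (g : ℝ → E) : ∫ t in Ioi (0 : ℝ), g t = ∫ v : ℝ, Real.exp v • g (Real.exp v) := by
  have h := integral_image_eq_integral_abs_deriv_smul MeasurableSet.univ
    (fun v _ => (Real.hasDerivAt_exp v).hasDerivWithinAt) Real.exp_injective.injOn g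
  simpa [image_univ, Real.range_exp] using h

theorem integrableOn_Ioi_zero_iff_integrable_exp {E : Type*} [NormedAddCommGroup E]
    [NormedSpace ℝ E] (g : ℝ → E) :
    IntegrableOn g (Ioi 0) ↔ Integrable fun v : ℝ => Real.exp v • g (Real.exp v) := by
  have h := integrableOn_image_iff_integrableOn_abs_deriv_smul MeasurableSet.univ
    (fun v _ => (Real.hasDerivAt_exp v).hasDerivWithinAt) Real.exp_injective.injOn g
  simpa [image_univ, Real.range_exp] using h

theorem integrable_exp_mul_sub_mul_exp (hs : 0 < s) (hb : 0 < b) :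
    Integrable fun v : ℝ => Real.exp (s * v - b * Real.exp v) := by
  have h := integrableOn_rpow_mul_exp_neg_mul_rpow (s := s - 1) (p := 1) (by linarith) one_pos hb
  refine ((integrableOn_Ioi_zero_iff_integrable_exp _).1 h).congr (.of_forall fun v => ?_)
  dsimp only
  rw [← Real.exp_mul, Real.rpow_one, smul_eq_mul, ← Real.exp_add, ← Real.exp_add]
  ring_nf

theorem tendsto_exp_mul_sub_mul_exp_atBot (hs : 0 < s) (b : ℝ) :
    Tendsto (fun v : ℝ => Real.exp (s * v - b * Real.exp v)) atBot (𝓝 0) :=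
  Real.tendsto_exp_atBot.comp <| (tendsto_id.const_mul_atBot hs).atBot_add
    (Real.tendsto_exp_atBot.const_mul b).neg

theorem tendsto_exp_mul_sub_mul_exp_atTop (s : ℝ) (hb : 0 < b) :
    Tendsto (fun v : ℝ => Real.exp (s * v - b * Real.exp v)) atTop (𝓝 0) := by
  have h := (tendsto_rpow_mul_exp_neg_mul_atTop_nhds_zero s b hb).comp Real.tendsto_exp_atTop
  refine h.congr fun v => ?_
  rw [Function.comp_apply, ← Real.exp_mul, ← Real.exp_add]
  ring_nf

theorem norm_cexp_mul_sub_cexp (s x y : ℝ) :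
    ‖cexp (s * (x + y * I) - cexp (x + y * I))‖ =
      Real.exp (s * x - Real.cos y * Real.exp x) := by
  simp [norm_exp, exp_re, mul_comm]

theorem norm_cexp_mul_sub_cexp_le (hθ : |θ| ≤ π) (s x : ℝ) {y : ℝ} (hy : |y| ≤ |θ|) :
    ‖cexp (s * (x + y * I) - cexp (x + y * I))‖ ≤ Real.exp (s * x - Real.cos θ * Real.exp x) := by
  have hcos : Real.cos θ ≤ Real.cos y := by
    rw [← Real.cos_abs θ, ← Real.cos_abs y]
    exact Real.cos_le_cos_of_nonneg_of_le_pi (abs_nonneg y) hθ hy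
  rw [norm_cexp_mul_sub_cexp]
  gcongr

theorem integrable_cexp_mul_sub_cexp (hs : 0 < s) (hθ : |θ| < π / 2) :
    Integrable fun v : ℝ => cexp (s * (v + θ * I) - cexp (v + θ * I)) := by
  refine (integrable_exp_mul_sub_mul_exp hs
    (Real.cos_pos_of_mem_Ioo (abs_lt.1 hθ))).mono' (by fun_prop) (.of_forall fun v => ?_)
  exact (norm_cexp_mul_sub_cexp s v θ).le

theorem integral_cexp_mul_sub_cexp_real (hs : 0 < s) :
    ∫ v : ℝ, cexp (s * v - cexp v) = Gamma s := by
  rw [Gamma_eq_integral (by simpa using hs), GammaIntegral, integral_Ioi_zero_eq_integral_exp]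
  congr with v
  rw [real_smul, ofReal_exp, cpow_def_of_ne_zero (exp_ne_zero _), ← ofReal_exp, ← ofReal_log
    (Real.exp_pos v).le, Real.log_exp, ofReal_exp, ofReal_exp, ← exp_add, ← exp_add]
  push_cast
  ring_nf

theorem integral_cexp_mul_sub_cexp (hs : 0 < s) (hθ : |θ| < π / 2) :
    ∫ v : ℝ, cexp (s * (v + θ * I) - cexp (v + θ * I)) = Gamma s := by
  have hcos : 0 < Real.cos θ := Real.cos_pos_of_mem_Ioo (abs_lt.1 hθ)
  have hshift := integral_horizontal_eq_integral_horizontal (c := 0) (d := θ)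
    (f := fun w => cexp (s * w - cexp w)) (by fun_prop)
    (integrable_cexp_mul_sub_cexp hs (by simpa using Real.pi_pos))
    (integrable_cexp_mul_sub_cexp hs hθ) (tendsto_exp_mul_sub_mul_exp_atBot hs _)
    (tendsto_exp_mul_sub_mul_exp_atTop s hcos) fun x y hy =>
      norm_cexp_mul_sub_cexp_le (by linarith [Real.pi_pos]) s x
        (by simpa using abs_sub_left_of_mem_uIcc hy)
  rw [← hshift]
  simpa using integral_cexp_mul_sub_cexp_real hs

theorem integral_rpow_mul_cexp_neg_mul_cexp (hs : 0 < s) {l : ℂ} (hl : |l.im| < π / 2) :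
    ∫ r in Ioi (0 : ℝ), ((r ^ (s - 1) : ℝ) : ℂ) * cexp (-(r * cexp l)) =
      cexp (-(s * l)) * Gamma s := by
  rw [← integral_cexp_mul_sub_cexp hs hl,
    ← integral_add_right_eq_self
      (fun v : ℝ => cexp (s * (v + l.im * I) - cexp (v + l.im * I))) l.re,
    ← integral_const_mul, integral_Ioi_zero_eq_integral_exp]
  congr with v
  have hl' : ((v + l.re : ℝ) : ℂ) + l.im * I = v + l := by
    rw [ofReal_add, add_assoc, re_add_im]
  rw [hl', ← Real.exp_mul, real_smul, ofReal_exp, ofReal_exp, ← exp_add, ← exp_add, ← exp_add,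
    ← exp_add]
  push_cast
  ring_nf

theorem integral_cexp_cexp_add_mul (hs : 0 < s) (hθ : π / 2 < θ) (hθ' : θ < 3 * π / 2) :
    ∫ v : ℝ, cexp (cexp (v + θ * I) + s * (v + θ * I)) = cexp (π * s * I) * Gamma s := by
  have hmem : |θ - π| < π / 2 := abs_lt.2 ⟨by linarith, by linarith⟩
  rw [← integral_cexp_mul_sub_cexp hs hmem, ← integral_const_mul]
  congr with v
  have hexp : cexp (v + θ * I) = -cexp (v + (θ - π : ℝ) * I) := by
    rw [← exp_add_pi_mul_I]
    push_cast
    ring_nf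
  rw [hexp, ← exp_add]
  push_cast
  ring_nf

theorem im_cexp_mul_Gamma (hs : 0 < s) :
    (cexp (π * s * I) * Gamma s).im = π * (Real.Gamma (1 - s))⁻¹ := by
  have hsin : (cexp (π * s * I) * Gamma s).im = Real.sin (π * s) * Real.Gamma s := by
    rw [Gamma_ofReal, im_mul_ofReal, ← ofReal_mul, exp_ofReal_mul_I_im]
  have hreflect := Real.Gamma_mul_Gamma_one_sub s
  have hΓ : 0 < Real.Gamma s := Real.Gamma_pos_of_pos hs
  rw [hsin]
  rcases eq_or_ne (Real.sin (π * s)) 0 with hzero | hne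
  · rw [hzero, div_zero] at hreflect
    simp [hzero, (mul_eq_zero.1 hreflect).resolve_left hΓ.ne']
  · have hΓ' : Real.Gamma (1 - s) ≠ 0 := fun h => by
      rw [h, mul_zero] at hreflect
      exact div_ne_zero Real.pi_ne_zero hne hreflect.symm
    rw [eq_div_iff hne] at hreflect
    rw [← div_eq_mul_inv, eq_div_iff hΓ']
    linear_combination hreflect

end Euler

/-! ### Termwise integration and entire power series -/

section Series

theorem hasSum_integral_mul_pow_div_factorial {α : Type*} [MeasurableSpace α] {μ : Measure α}
    {f g : α → ℂ} (hf : AEStronglyMeasurable f μ) (hg : AEStronglyMeasurable g μ)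
    (hfg : Integrable (fun a => ‖f a‖ * Real.exp ‖g a‖) μ) :
    HasSum (fun n : ℕ => ∫ a, f a * (g a ^ n / n.factorial) ∂μ) (∫ a, f a * cexp (g a) ∂μ) := by
  have hbound (a : α) : HasSum (fun n : ℕ => ‖f a‖ * (‖g a‖ ^ n / n.factorial))
      (‖f a‖ * Real.exp ‖g a‖) := by
    rw [Real.exp_eq_exp_ℝ]
    exact (NormedSpace.expSeries_div_hasSum_exp ‖g a‖).mul_left _
  refine hasSum_integral_of_dominated_convergence
    (fun n a => ‖f a‖ * (‖g a‖ ^ n / n.factorial)) (fun n => ?_) (fun n => ?_)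
    (.of_forall fun a => (hbound a).summable) ?_ (.of_forall fun a => ?_)
  · exact hf.mul ((hg.pow n).mul_const _)
  · exact .of_forall fun a => by simp
  · simpa only [(hbound _).tsum_eq] using hfg
  · rw [exp_eq_exp_ℂ]
    exact (NormedSpace.expSeries_div_hasSum_exp (g a)).mul_left _

theorem differentiable_tsum_mul_pow {c : ℕ → ℂ}
    (hc : ∀ r : ℝ, Summable fun n => c n * (r : ℂ) ^ n) :
    Differentiable ℂ fun z => ∑' n, c n * z ^ n := by
  set p := FormalMultilinearSeries.ofScalars ℂ c with hp
  have hradius : p.radius = ⊤ := p.radius_eq_top_of_summable_norm fun r => by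
    simpa [hp, FormalMultilinearSeries.ofScalars_norm] using (hc r).norm
  have hball := p.hasFPowerSeriesOnBall (by simp [hradius])
  have hsum : p.sum = fun z => ∑' n, c n * z ^ n :=
    FormalMultilinearSeries.ofScalarsSum_eq_tsum (E := ℂ) c
  rw [← hsum]
  exact fun z => hball.differentiableOn.differentiableAt (by simp [hradius])

end Series

/-! ### The M-Wright function -/

section Wright

variable {β θ : ℝ}

/-- The integrand of the Hankel-type representation of `M_β(r)`, whose contour variable `ζ = exp w`
is parametrised by its logarithm `w`. -/
noncomputable def wrightKernel (β r : ℝ) (w : ℂ) : ℂ :=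
  cexp (cexp w - r * cexp (β * w) + β * w)

theorem differentiable_wrightKernel (β r : ℝ) : Differentiable ℂ (wrightKernel β r) := by
  unfold wrightKernel
  fun_prop

theorem norm_wrightKernel (β r x y : ℝ) :
    ‖wrightKernel β r (x + y * I)‖ = Real.exp (Real.cos y * Real.exp x -
      r * (Real.cos (β * y) * Real.exp (β * x)) + β * x) := by
  simp [wrightKernel, norm_exp, exp_re, mul_comm]

theorem wrightKernel_ofReal (β r x : ℝ) :
    wrightKernel β r x = (Real.exp (Real.exp x - r * Real.exp (β * x) + β * x) : ℝ) := by
  push_cast [wrightKernel]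
  rfl

theorem cos_neg_of_pi_div_two_lt_of_lt_pi (hθ : π / 2 < θ) (hθπ : θ < π) : Real.cos θ < 0 :=
  Real.cos_neg_of_pi_div_two_lt_of_lt hθ (by linarith [Real.pi_pos])

theorem exists_angle (hβ₀ : 0 < β) (hβ₁ : β < 1) :
    ∃ θ, π / 2 < θ ∧ θ < π ∧ |β * θ| < π / 2 := by
  have hlt : π / 2 < min π (π / 2 / β) :=
    lt_min (by linarith [Real.pi_pos])
      ((lt_div_iff₀ hβ₀).2 (mul_lt_of_lt_one_right (by positivity) hβ₁))
  obtain ⟨θ, hθ, hθlt⟩ := exists_between hlt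
  have hθ₀ : 0 < θ := by linarith [Real.pi_pos]
  refine ⟨θ, hθ, hθlt.trans_le (min_le_left _ _), ?_⟩
  rw [abs_of_pos (mul_pos hβ₀ hθ₀), mul_comm, ← lt_div_iff₀ hβ₀]
  exact hθlt.trans_le (min_le_right _ _)

theorem exists_mul_exp_mul_le (hβ₀ : 0 ≤ β) (hβ₁ : β < 1) {R b : ℝ} (hR : 0 ≤ R) (hb : 0 < b) :
    ∃ D, ∀ v : ℝ, R * Real.exp (β * v) ≤ D + b * Real.exp v := by
  obtain ⟨k, hk⟩ : ∃ k, R / b ≤ Real.exp ((1 - β) * k) :=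
    ((Real.tendsto_exp_atTop.comp (tendsto_id.const_mul_atTop (sub_pos.2 hβ₁))).eventually_ge_atTop
      (R / b)).exists
  rw [div_le_iff₀' hb] at hk
  refine ⟨R * Real.exp (β * k), fun v => ?_⟩
  rcases le_total v k with hvk | hkv
  · have : R * Real.exp (β * v) ≤ R * Real.exp (β * k) := by gcongr
    linarith [mul_pos hb (Real.exp_pos v)]
  · calc R * Real.exp (β * v) ≤ b * Real.exp ((1 - β) * v) * Real.exp (β * v) := by
          gcongr
          exact hk.trans (by gcongr)
      _ = b * Real.exp v := by rw [mul_assoc, ← Real.exp_add]; ring_nf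
      _ ≤ R * Real.exp (β * k) + b * Real.exp v := le_add_of_nonneg_left (by positivity)

theorem integrable_exp_mul_exp_add_sub (hβ₀ : 0 < β) (hβ₁ : β < 1) {R b : ℝ} (hR : 0 ≤ R)
    (hb : 0 < b) :
    Integrable fun v : ℝ => Real.exp (β * v - b * Real.exp v) *
      Real.exp (R * Real.exp (β * v)) := by
  obtain ⟨D, hD⟩ := exists_mul_exp_mul_le hβ₀.le hβ₁ hR (half_pos hb)
  refine ((integrable_exp_mul_sub_mul_exp hβ₀ (half_pos hb)).const_mul (Real.exp D)).mono'
    (by fun_prop) (.of_forall fun v => ?_)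
  rw [Real.norm_of_nonneg (by positivity), ← Real.exp_add, ← Real.exp_add]
  exact Real.exp_le_exp.2 (by linarith [hD v])

theorem wrightKernel_eq_mul_exp (β r : ℝ) (w : ℂ) :
    wrightKernel β r w = cexp (cexp w + β * w) * cexp (-(r * cexp (β * w))) := by
  rw [wrightKernel, ← exp_add]
  ring_nf

theorem cexp_add_mul_pow_div_factorial (β r : ℝ) (w : ℂ) (n : ℕ) :
    cexp (cexp w + β * w) * ((-(r * cexp (β * w))) ^ n / n.factorial) =
      ((-r) ^ n / n.factorial : ℝ) * cexp (cexp w + (β * (n + 1) : ℝ) * w) := by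
  have hpow : cexp (cexp w + (β * (n + 1) : ℝ) * w) =
      cexp (cexp w + β * w) * cexp (β * w) ^ n := by
    rw [← exp_nat_mul, ← exp_add]
    push_cast
    ring_nf
  rw [hpow, ← neg_mul, mul_pow]
  push_cast
  ring

theorem norm_cexp_cexp_add_mul (β x y : ℝ) :
    ‖cexp (cexp (x + y * I) + β * (x + y * I))‖ =
      Real.exp (β * x - -Real.cos y * Real.exp x) := by
  simp [norm_exp, exp_re, mul_comm, add_comm]

theorem norm_neg_mul_cexp_mul (β r x y : ℝ) :
    ‖-(r * cexp (β * (x + y * I)))‖ = |r| * Real.exp (β * x) := by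
  simp [norm_exp]

theorem hasSum_integral_wrightKernel (hβ₀ : 0 < β) (hβ₁ : β < 1) (hθ : π / 2 < θ) (hθπ : θ < π)
    (r : ℝ) :
    HasSum (fun n : ℕ => (((-r) ^ n / n.factorial : ℝ) : ℂ) *
        (cexp (π * (β * (n + 1) : ℝ) * I) * Gamma (β * (n + 1) : ℝ)))
      (∫ v : ℝ, wrightKernel β r (v + θ * I)) := by
  have hcos := cos_neg_of_pi_div_two_lt_of_lt_pi hθ hθπ
  simp only [wrightKernel_eq_mul_exp]
  refine (hasSum_integral_mul_pow_div_factorial (by fun_prop) (by fun_prop) ?_).congr_fun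
    fun n => ?_
  · simp only [norm_cexp_cexp_add_mul, norm_neg_mul_cexp_mul]
    exact integrable_exp_mul_exp_add_sub hβ₀ hβ₁ (abs_nonneg r) (neg_pos.2 hcos)
  · simp only [cexp_add_mul_pow_div_factorial]
    rw [integral_const_mul, integral_cexp_cexp_add_mul (by positivity) hθ (by linarith)]

theorem hasSum_mWright (hβ₀ : 0 < β) (hβ₁ : β < 1) (hθ : π / 2 < θ) (hθπ : θ < π) (r : ℝ) :
    HasSum (fun n : ℕ => (-(r : ℂ)) ^ n / (n.factorial * Gamma (-(β : ℂ) * n + 1 - β)))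
      ((π⁻¹ * (∫ v : ℝ, wrightKernel β r (v + θ * I)).im : ℝ) : ℂ) := by
  have him := hasSum_im (hasSum_integral_wrightKernel hβ₀ hβ₁ hθ hθπ r)
  refine (hasSum_ofReal.2 (him.mul_left π⁻¹)).congr_fun fun n => ?_
  have hΓ : Gamma (-(β : ℂ) * n + 1 - β) = (Real.Gamma (1 - β * (n + 1)) : ℝ) := by
    rw [← Gamma_ofReal]
    push_cast
    ring_nf
  rw [im_ofReal_mul, im_cexp_mul_Gamma (by positivity), hΓ]
  push_cast
  field_simp

theorem mWright_eq_integral (hβ₀ : 0 < β) (hβ₁ : β < 1) (hθ : π / 2 < θ) (hθπ : θ < π) (r : ℝ) :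
    mWright β r = (π⁻¹ * (∫ v : ℝ, wrightKernel β r (v + θ * I)).im : ℝ) :=
  (hasSum_mWright hβ₀ hβ₁ hθ hθπ r).tsum_eq

theorem continuous_mWright (hβ₀ : 0 < β) (hβ₁ : β < 1) : Continuous fun r : ℝ => mWright β r := by
  obtain ⟨θ, hθ, hθπ, -⟩ := exists_angle hβ₀ hβ₁
  set c : ℕ → ℂ := fun n => (-1) ^ n / (n.factorial * Gamma (-(β : ℂ) * n + 1 - β)) with hc
  have hterm (z : ℂ) (n : ℕ) :
      (-z) ^ n / (n.factorial * Gamma (-(β : ℂ) * n + 1 - β)) = c n * z ^ n := by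
    rw [hc, neg_pow]
    ring
  have hentire : Differentiable ℂ (mWright β) := by
    unfold mWright
    simp only [hterm]
    refine differentiable_tsum_mul_pow fun r => ?_
    simpa only [hterm] using (hasSum_mWright hβ₀ hβ₁ hθ hθπ r).summable
  exact hentire.continuous.comp continuous_ofReal

theorem norm_wrightKernel_le {r x y A : ℝ} (hr : 0 ≤ r)
    (hA : A ≤ Real.cos (β * y) * Real.exp (β * x)) :
    ‖wrightKernel β r (x + y * I)‖ ≤
      Real.exp (-A * r) * Real.exp (β * x - -Real.cos y * Real.exp x) := by
  rw [norm_wrightKernel, ← Real.exp_add]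
  exact Real.exp_le_exp.2 (by linarith [mul_le_mul_of_nonneg_left hA hr])

theorem cos_mul_le_cos_mul_of_mem_uIcc (hβθ : |β * θ| < π / 2) {y : ℝ} (hy : y ∈ uIcc 0 θ) :
    Real.cos (β * θ) ≤ Real.cos (β * y) := by
  have hyθ : |y| ≤ |θ| := by simpa using abs_sub_left_of_mem_uIcc hy
  rw [← Real.cos_abs (β * θ), ← Real.cos_abs (β * y)]
  refine Real.cos_le_cos_of_nonneg_of_le_pi (abs_nonneg _) (by linarith [Real.pi_pos]) ?_
  rw [abs_mul, abs_mul]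
  gcongr

theorem norm_wrightKernel_le_of_mem_uIcc (hβθ : |β * θ| < π / 2) {r x y : ℝ} (hr : 0 ≤ r)
    (hy : y ∈ uIcc 0 θ) :
    ‖wrightKernel β r (x + y * I)‖ ≤ Real.exp (-(Real.cos (β * θ) * Real.exp (β * x)) * r) *
      Real.exp (β * x - -1 * Real.exp x) := by
  refine (norm_wrightKernel_le hr (mul_le_mul_of_nonneg_right
    (cos_mul_le_cos_mul_of_mem_uIcc hβθ hy) (Real.exp_pos _).le)).trans ?_
  gcongr
  exact Real.cos_le_one y

theorem norm_wrightKernel_le_exp_of_mem_uIcc (hβθ : |β * θ| < π / 2) {r x y : ℝ} (hr : 0 ≤ r)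
    (hy : y ∈ uIcc 0 θ) :
    ‖wrightKernel β r (x + y * I)‖ ≤ Real.exp (β * x - -1 * Real.exp x) := by
  have hcos : 0 < Real.cos (β * θ) := Real.cos_pos_of_mem_Ioo (abs_lt.1 hβθ)
  refine (norm_wrightKernel_le_of_mem_uIcc hβθ hr hy).trans
    (mul_le_of_le_one_left (Real.exp_pos _).le (Real.exp_le_one_iff.2 ?_))
  rw [neg_mul, neg_nonpos]
  positivity

theorem integrableOn_Iic_wrightKernel (hβ₀ : 0 < β) (hβθ : |β * θ| < π / 2) {r y : ℝ} (hr : 0 ≤ r)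
    (hy : y ∈ uIcc 0 θ) (l : ℝ) :
    IntegrableOn (fun x : ℝ => wrightKernel β r (x + y * I)) (Iic l) := by
  refine Integrable.mono' ((integrableOn_exp_mul_Iic hβ₀ l).mul_const (Real.exp (Real.exp l)))
    ((differentiable_wrightKernel β r).continuous.comp (by fun_prop)).aestronglyMeasurable ?_
  filter_upwards [ae_restrict_mem measurableSet_Iic] with x hx
  refine (norm_wrightKernel_le_exp_of_mem_uIcc hβθ hr hy).trans ?_
  rw [← Real.exp_add]
  exact Real.exp_le_exp.2 (by linarith [Real.exp_le_exp.2 (mem_Iic.1 hx)])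

-- The kernel is real on the real axis, so moving `Iic l + θ i` there leaves only the arc.
theorem im_integral_Iic_wrightKernel (hβ₀ : 0 < β) (hβθ : |β * θ| < π / 2) {r : ℝ} (hr : 0 ≤ r)
    (l : ℝ) :
    (∫ v in Iic l, wrightKernel β r (v + θ * I)).im =
      (∫ y in (0 : ℝ)..θ, wrightKernel β r (l + y * I)).re := by
  have hstrip := halfStripBoundaryIntegral_eq_zero (b := l) (c := 0) (d := θ)
    (differentiable_wrightKernel β r).differentiableOn
    (integrableOn_Iic_wrightKernel hβ₀ hβθ hr left_mem_uIcc l)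
    (integrableOn_Iic_wrightKernel hβ₀ hβθ hr right_mem_uIcc l)
    (tendsto_exp_mul_sub_mul_exp_atBot hβ₀ (-1))
    (fun x y hy => norm_wrightKernel_le_exp_of_mem_uIcc hβθ hr hy)
  rw [halfStripBoundaryIntegral, sub_eq_zero] at hstrip
  rw [← hstrip]
  simp only [ofReal_zero, zero_mul, add_zero, wrightKernel_ofReal]
  rw [integral_complex_ofReal, add_im, ofReal_im, I_mul_im, zero_add]

theorem norm_integral_arc_wrightKernel_le (hβθ : |β * θ| < π / 2) {r : ℝ} (hr : 0 ≤ r) (l : ℝ) :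
    ‖∫ y in (0 : ℝ)..θ, wrightKernel β r (l + y * I)‖ ≤
      Real.exp (-(Real.cos (β * θ) * Real.exp (β * l)) * r) *
        Real.exp (β * l - -1 * Real.exp l) * |θ| := by
  simpa using intervalIntegral.norm_integral_le_of_norm_le_const fun y hy =>
    norm_wrightKernel_le_of_mem_uIcc hβθ (x := l) hr (uIoc_subset_uIcc hy)

theorem integrable_wrightKernel (hβ₀ : 0 < β) (hθ : π / 2 < θ) (hθπ : θ < π)
    (hβθ : |β * θ| < π / 2) {r : ℝ} (hr : 0 ≤ r) :
    Integrable fun v : ℝ => wrightKernel β r (v + θ * I) := by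
  have hcos := cos_neg_of_pi_div_two_lt_of_lt_pi hθ hθπ
  have hcosβ : 0 < Real.cos (β * θ) := Real.cos_pos_of_mem_Ioo (abs_lt.1 hβθ)
  refine (integrable_exp_mul_sub_mul_exp hβ₀ (neg_pos.2 hcos)).mono'
    ((differentiable_wrightKernel β r).continuous.comp (by fun_prop)).aestronglyMeasurable
    (.of_forall fun v => ?_)
  simpa using norm_wrightKernel_le (A := 0) hr (by positivity)

theorem norm_integral_Ioi_wrightKernel_le (hβ₀ : 0 < β) (hθ : π / 2 < θ) (hθπ : θ < π)
    (hβθ : |β * θ| < π / 2) {r : ℝ} (hr : 0 ≤ r) (l : ℝ) :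
    ‖∫ v in Ioi l, wrightKernel β r (v + θ * I)‖ ≤
      Real.exp (-(Real.cos (β * θ) * Real.exp (β * l)) * r) *
        ∫ v in Ioi l, Real.exp (β * v - -Real.cos θ * Real.exp v) := by
  have hcos := cos_neg_of_pi_div_two_lt_of_lt_pi hθ hθπ
  have hcosβ : 0 < Real.cos (β * θ) := Real.cos_pos_of_mem_Ioo (abs_lt.1 hβθ)
  rw [← integral_const_mul]
  refine norm_integral_le_of_norm_le
    ((integrable_exp_mul_sub_mul_exp hβ₀ (neg_pos.2 hcos)).integrableOn.const_mul _) ?_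
  filter_upwards [ae_restrict_mem measurableSet_Ioi] with v hv
  refine norm_wrightKernel_le hr ?_
  have hlv : l ≤ v := le_of_lt hv
  gcongr

theorem exists_norm_mWright_le_exp (hβ₀ : 0 < β) (hβ₁ : β < 1) (A : ℝ) :
    ∃ C, ∀ r : ℝ, 0 ≤ r → ‖mWright β r‖ ≤ C * Real.exp (-A * r) := by
  obtain ⟨θ, hθ, hθπ, hβθ⟩ := exists_angle hβ₀ hβ₁
  have hcosβ : 0 < Real.cos (β * θ) := Real.cos_pos_of_mem_Ioo (abs_lt.1 hβθ)
  obtain ⟨l, hl⟩ : ∃ l, A ≤ Real.cos (β * θ) * Real.exp (β * l) :=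
    (((Real.tendsto_exp_atTop.comp (tendsto_id.const_mul_atTop hβ₀)).const_mul_atTop
      hcosβ).eventually_ge_atTop A).exists
  set K := Real.exp (β * l - -1 * Real.exp l) * |θ|
  set J := ∫ v in Ioi l, Real.exp (β * v - -Real.cos θ * Real.exp v)
  have : 0 ≤ J := integral_nonneg fun v => (Real.exp_pos _).le
  refine ⟨π⁻¹ * (K + J), fun r hr => ?_⟩
  have hsplit := intervalIntegral.integral_Iic_add_Ioi (b := l)
    (integrable_wrightKernel hβ₀ hθ hθπ hβθ hr).integrableOn
    (integrable_wrightKernel hβ₀ hθ hθπ hβθ hr).integrableOn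
  rw [mWright_eq_integral hβ₀ hβ₁ hθ hθπ, norm_real, ← hsplit, add_im,
    im_integral_Iic_wrightKernel hβ₀ hβθ hr, norm_mul, Real.norm_of_nonneg (by positivity),
    mul_assoc]
  gcongr
  calc _ ≤ ‖∫ y in (0 : ℝ)..θ, wrightKernel β r (l + y * I)‖ +
        ‖∫ v in Ioi l, wrightKernel β r (v + θ * I)‖ :=
        (abs_add_le _ _).trans (add_le_add (abs_re_le_norm _) (abs_im_le_norm _))
    _ ≤ (K + J) * Real.exp (-(Real.cos (β * θ) * Real.exp (β * l)) * r) := by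
        linarith [norm_integral_arc_wrightKernel_le hβθ hr l,
          norm_integral_Ioi_wrightKernel_le hβ₀ hθ hθπ hβθ hr l]
    _ ≤ (K + J) * Real.exp (-A * r) := by gcongr

theorem norm_rpow_mul_wrightKernel {r : ℝ} (hr : 0 ≤ r) (s v : ℝ) :
    ‖((r ^ s : ℝ) : ℂ) * wrightKernel β r (v + θ * I)‖ =
      Real.exp (β * v - -Real.cos θ * Real.exp v) *
        (r ^ s * Real.exp (-(Real.exp (β * v) * Real.cos (β * θ) * r))) := by
  rw [norm_mul, norm_real, Real.norm_of_nonneg (by positivity), norm_wrightKernel,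
    mul_left_comm (Real.exp _), ← Real.exp_add]
  ring_nf

theorem integral_norm_rpow_mul_wrightKernel (hβθ : |β * θ| < π / 2) {s : ℝ} (hs : 0 < s) (v : ℝ) :
    ∫ r in Ioi (0 : ℝ), ‖((r ^ (s - 1) : ℝ) : ℂ) * wrightKernel β r (v + θ * I)‖ =
      Real.cos (β * θ) ^ (-s) * Real.Gamma s *
        Real.exp (β * (1 - s) * v - -Real.cos θ * Real.exp v) := by
  have hcos : 0 < Real.cos (β * θ) := Real.cos_pos_of_mem_Ioo (abs_lt.1 hβθ)
  rw [setIntegral_congr_fun measurableSet_Ioi fun r hr =>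
      norm_rpow_mul_wrightKernel (le_of_lt hr) (s - 1) v,
    integral_const_mul, Real.integral_rpow_mul_exp_neg_mul_Ioi hs (by positivity), one_div,
    Real.inv_rpow (by positivity), ← Real.rpow_neg (by positivity),
    Real.mul_rpow (by positivity) hcos.le, ← Real.exp_mul, ← mul_assoc, ← mul_assoc,
    ← Real.exp_add, mul_assoc, mul_comm]
  ring_nf

theorem integrable_prod_rpow_mul_wrightKernel (hβ₀ : 0 < β) (hθ : π / 2 < θ) (hθπ : θ < π)
    (hβθ : |β * θ| < π / 2) {s : ℝ} (hs₀ : 0 < s) (hs₁ : s < 1) :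
    Integrable (Function.uncurry fun r v : ℝ =>
        ((r ^ (s - 1) : ℝ) : ℂ) * wrightKernel β r (v + θ * I))
      ((volume.restrict (Ioi 0)).prod volume) := by
  have hcosθ := cos_neg_of_pi_div_two_lt_of_lt_pi hθ hθπ
  have hcos : 0 < Real.cos (β * θ) := Real.cos_pos_of_mem_Ioo (abs_lt.1 hβθ)
  have hmeas : Measurable (Function.uncurry fun r v : ℝ =>
      ((r ^ (s - 1) : ℝ) : ℂ) * wrightKernel β r (v + θ * I)) := by
    unfold Function.uncurry wrightKernel
    fun_prop
  rw [integrable_prod_iff' hmeas.aestronglyMeasurable]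
  constructor
  · refine .of_forall fun v => ?_
    have hInt := integrableOn_rpow_mul_exp_neg_mul_rpow (s := s - 1) (p := 1) (by linarith) one_pos
      (mul_pos (Real.exp_pos (β * v)) hcos)
    refine (hInt.const_mul (Real.exp (β * v - -Real.cos θ * Real.exp v))).mono'
      (hmeas.comp measurable_prodMk_right).aestronglyMeasurable ?_
    filter_upwards [ae_restrict_mem measurableSet_Ioi] with r hr
    rw [Function.uncurry_apply_pair, norm_rpow_mul_wrightKernel (le_of_lt hr), Real.rpow_one,
      neg_mul (Real.exp _ * _)]
  · simp only [Function.uncurry_apply_pair, integral_norm_rpow_mul_wrightKernel hβθ hs₀]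
    exact (integrable_exp_mul_sub_mul_exp (mul_pos hβ₀ (by linarith)) (neg_pos.2 hcosθ)).const_mul _

theorem integral_rpow_mul_integral_wrightKernel (hβ₀ : 0 < β) (hθ : π / 2 < θ) (hθπ : θ < π)
    (hβθ : |β * θ| < π / 2) {s : ℝ} (hs₀ : 0 < s) (hs₁ : s < 1) :
    ∫ r in Ioi (0 : ℝ), ((r ^ (s - 1) : ℝ) : ℂ) * ∫ v : ℝ, wrightKernel β r (v + θ * I) =
      Real.Gamma s * (cexp (π * (β * (1 - s) : ℝ) * I) * Gamma (β * (1 - s) : ℝ)) := by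
  have hpos : 0 < β * (1 - s) := mul_pos hβ₀ (by linarith)
  have hinner (v : ℝ) : ∫ r in Ioi (0 : ℝ), ((r ^ (s - 1) : ℝ) : ℂ) *
      wrightKernel β r (v + θ * I) =
        Real.Gamma s * cexp (cexp (v + θ * I) + (β * (1 - s) : ℝ) * (v + θ * I)) := by
    simp only [wrightKernel_eq_mul_exp, mul_left_comm _ (cexp (cexp _ + _))]
    rw [integral_const_mul, integral_rpow_mul_cexp_neg_mul_cexp hs₀ (by simpa using hβθ),
      ← mul_assoc, ← exp_add, mul_comm, Gamma_ofReal]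
    push_cast
    ring_nf
  simp only [← integral_const_mul]
  rw [integral_integral_swap (integrable_prod_rpow_mul_wrightKernel hβ₀ hθ hθπ hβθ hs₀ hs₁)]
  simp only [hinner]
  rw [integral_const_mul, integral_cexp_cexp_add_mul hpos hθ (by linarith)]

theorem mellin_ofReal_eq_integral (f : ℝ → ℂ) (s : ℝ) :
    mellin f s = ∫ r in Ioi (0 : ℝ), ((r ^ (s - 1) : ℝ) : ℂ) * f r := by
  refine setIntegral_congr_fun measurableSet_Ioi fun r hr => ?_
  rw [smul_eq_mul, ofReal_cpow (le_of_lt hr)]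
  push_cast
  rfl

theorem mellin_mWright_of_lt_one (hβ₀ : 0 < β) (hβ₁ : β < 1) {s : ℝ} (hs₀ : 0 < s) (hs₁ : s < 1) :
    mellin (fun r : ℝ => mWright β r) s = Gamma s * (Gamma (1 - β + β * s))⁻¹ := by
  obtain ⟨θ, hθ, hθπ, hβθ⟩ := exists_angle hβ₀ hβ₁
  have hpos : 0 < β * (1 - s) := mul_pos hβ₀ (by linarith)
  have hInt := (integrable_prod_rpow_mul_wrightKernel hβ₀ hθ hθπ hβθ hs₀ hs₁).integral_prod_left
  simp only [Function.uncurry_apply_pair, integral_const_mul] at hInt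
  have him : ∫ r in Ioi (0 : ℝ), r ^ (s - 1) * (∫ v : ℝ, wrightKernel β r (v + θ * I)).im =
      Real.Gamma s * (π * (Real.Gamma (1 - β * (1 - s)))⁻¹) := by
    rw [← im_cexp_mul_Gamma hpos, ← im_ofReal_mul,
      ← integral_rpow_mul_integral_wrightKernel hβ₀ hθ hθπ hβθ hs₀ hs₁]
    simpa only [imCLM_apply, im_ofReal_mul] using imCLM.integral_comp_comm hInt
  have hΓ : Gamma (1 - β + β * s) = (Real.Gamma (1 - β * (1 - s)) : ℝ) := by
    rw [← Gamma_ofReal]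
    push_cast
    ring_nf
  rw [hΓ, Gamma_ofReal, mellin_ofReal_eq_integral]
  simp only [mWright_eq_integral hβ₀ hβ₁ hθ hθπ, ← ofReal_mul, mul_left_comm _ π⁻¹]
  rw [integral_complex_ofReal, integral_const_mul, him]
  push_cast
  field_simp

theorem differentiableAt_mellin_mWright (hβ₀ : 0 < β) (hβ₁ : β < 1) {s : ℂ} (hs : 0 < s.re) :
    DifferentiableAt ℂ (mellin fun r : ℝ => mWright β r) s := by
  obtain ⟨C, hC⟩ := exists_norm_mWright_le_exp hβ₀ hβ₁ 1
  have hcont := continuous_mWright hβ₀ hβ₁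
  refine mellin_differentiableAt_of_isBigO_rpow_exp one_pos
    (hcont.locallyIntegrable.locallyIntegrableOn _) ?_ ?_ hs
  · refine Asymptotics.IsBigO.of_bound C ?_
    filter_upwards [eventually_ge_atTop 0] with r hr
    simpa using hC r hr
  · simpa using (hcont.tendsto 0).isBigO_one ℝ |>.mono nhdsWithin_le_nhds

theorem mellin_mWright (hβ₀ : 0 < β) (hβ₁ : β < 1) {s : ℂ} (hs : 0 < s.re) :
    mellin (fun r : ℝ => mWright β r) s = Gamma s * (Gamma (1 - β + β * s))⁻¹ := by
  set U : Set ℂ := {s | 0 < s.re}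
  have hU : IsOpen U := isOpen_lt continuous_const continuous_re
  have hleft : AnalyticOnNhd ℂ (mellin fun r : ℝ => mWright β r) U :=
    DifferentiableOn.analyticOnNhd (fun s hs =>
      (differentiableAt_mellin_mWright hβ₀ hβ₁ hs).differentiableWithinAt) hU
  have hright : AnalyticOnNhd ℂ (fun s => Gamma s * (Gamma (1 - β + β * s))⁻¹) U :=
    DifferentiableOn.analyticOnNhd (fun s hs => ((differentiableAt_Gamma_of_re_pos hs).mul
      (DifferentiableAt.comp s (f := fun s : ℂ => 1 - (β : ℂ) + β * s)
        (differentiable_one_div_Gamma _) (by fun_prop))).differentiableWithinAt) hU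
  have hfreq : ∃ᶠ t in 𝓝[≠] ((1 / 2 : ℝ) : ℂ), mellin (fun r : ℝ => mWright β r) t =
      Gamma t * (Gamma (1 - β + β * t))⁻¹ := by
    have hreal : ∀ᶠ t : ℝ in 𝓝[≠] (1 / 2), mellin (fun r : ℝ => mWright β r) t =
        Gamma t * (Gamma (1 - β + β * t))⁻¹ := by
      filter_upwards [mem_nhdsWithin_of_mem_nhds
        (Ioo_mem_nhds (a := (0 : ℝ)) (b := 1) (by norm_num) (by norm_num))] with t ht
      exact mellin_mWright_of_lt_one hβ₀ hβ₁ ht.1 ht.2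
    exact (continuous_ofReal.continuousAt.continuousWithinAt.tendsto_nhdsWithin
      fun t ht => ofReal_injective.ne ht).frequently hreal.frequently
  exact hleft.eqOn_of_preconnected_of_frequently_eq hright
    (convex_halfSpace_re_gt 0).isPreconnected (by simp [U]) hfreq hs

end Wright

/-! ### The Laplace transform of the M-Wright function -/

section Laplace

variable {f : ℝ → ℂ} {β ρ : ℝ} {z : ℂ}

theorem norm_mul_rpow_mul_exp_norm_eqOn (f : ℝ → ℂ) (ρ : ℝ) (z : ℂ) :
    EqOn (fun r : ℝ => ‖f r‖ * r ^ (ρ - 1) * Real.exp (‖z‖ * r))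
      (fun r : ℝ => ‖f r * ((r ^ (ρ - 1) : ℝ) : ℂ)‖ * Real.exp ‖-(r : ℂ) * z‖) (Ioi 0) := by
  intro r (hr : 0 < r)
  dsimp only
  rw [norm_mul, norm_real, Real.norm_of_nonneg (by positivity), norm_mul, norm_neg, norm_real,
    Real.norm_of_nonneg hr.le, mul_comm r]

theorem integrableOn_mul_rpow_mul_cexp (hf : AEStronglyMeasurable f (volume.restrict (Ioi 0)))
    (hInt : IntegrableOn (fun r : ℝ => ‖f r‖ * r ^ (ρ - 1) * Real.exp (‖z‖ * r)) (Ioi 0)) :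
    IntegrableOn (fun r : ℝ => f r * ((r ^ (ρ - 1) : ℝ) : ℂ) * cexp (-(r : ℂ) * z)) (Ioi 0) := by
  refine Integrable.mono' (hInt.congr_fun (norm_mul_rpow_mul_exp_norm_eqOn f ρ z)
    measurableSet_Ioi) ?_ (.of_forall fun r => ?_)
  · exact (hf.mul (by fun_prop)).mul (by fun_prop)
  · rw [norm_mul]
    gcongr
    exact norm_exp_le_exp_norm _

theorem integral_mul_rpow_mul_pow_eq_mellin (f : ℝ → ℂ) (ρ : ℝ) (z : ℂ) (k : ℕ) :
    ∫ r in Ioi (0 : ℝ), f r * ((r ^ (ρ - 1) : ℝ) : ℂ) * ((-(r : ℂ) * z) ^ k / k.factorial) =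
      (-z) ^ k / k.factorial * mellin f (ρ + k) := by
  have hmellin := mellin_ofReal_eq_integral f (ρ + k)
  push_cast at hmellin
  rw [hmellin, ← integral_const_mul]
  refine setIntegral_congr_fun measurableSet_Ioi fun r hr => ?_
  have hpow : r ^ (ρ + k - 1) = r ^ (ρ - 1) * r ^ k := by
    rw [add_sub_right_comm, Real.rpow_add_natCast (ne_of_gt hr)]
  rw [hpow, neg_mul_comm, mul_pow]
  push_cast
  ring

theorem hasSum_mellin_laplace (hf : AEStronglyMeasurable f (volume.restrict (Ioi 0)))
    (hInt : IntegrableOn (fun r : ℝ => ‖f r‖ * r ^ (ρ - 1) * Real.exp (‖z‖ * r)) (Ioi 0)) :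
    HasSum (fun k : ℕ => (-z) ^ k / k.factorial * mellin f (ρ + k))
      (∫ r in Ioi (0 : ℝ), f r * ((r ^ (ρ - 1) : ℝ) : ℂ) * cexp (-(r : ℂ) * z)) := by
  simp only [← integral_mul_rpow_mul_pow_eq_mellin]
  exact hasSum_integral_mul_pow_div_factorial (hf.mul (by fun_prop)) (by fun_prop)
    (hInt.congr_fun (norm_mul_rpow_mul_exp_norm_eqOn f ρ z) measurableSet_Ioi)

theorem integrableOn_norm_mWright_mul_rpow_mul_exp (hβ₀ : 0 < β) (hβ₁ : β < 1) (hρ : 0 < ρ)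
    (a : ℝ) :
    IntegrableOn (fun r : ℝ => ‖mWright β r‖ * r ^ (ρ - 1) * Real.exp (a * r)) (Ioi 0) := by
  obtain ⟨C, hC⟩ := exists_norm_mWright_le_exp hβ₀ hβ₁ (a + 1)
  have hcont := continuous_mWright hβ₀ hβ₁
  refine Integrable.mono' ((Real.GammaIntegral_convergent hρ).const_mul C) ?_ ?_
  · exact (hcont.norm.aestronglyMeasurable.mul (by fun_prop)).mul (by fun_prop)
  · filter_upwards [ae_restrict_mem measurableSet_Ioi] with r (hr : 0 < r)
    rw [Real.norm_of_nonneg (by positivity)]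
    calc ‖mWright β r‖ * r ^ (ρ - 1) * Real.exp (a * r)
        ≤ C * Real.exp (-(a + 1) * r) * r ^ (ρ - 1) * Real.exp (a * r) := by
          gcongr
          exact hC r hr.le
      _ = C * (Real.exp (-(a + 1) * r) * Real.exp (a * r) * r ^ (ρ - 1)) := by ring
      _ = C * (Real.exp (-r) * r ^ (ρ - 1)) := by
          rw [← Real.exp_add]
          ring_nf

theorem integrableOn_mWright_laplace (hβ₀ : 0 < β) (hβ₁ : β < 1) (hρ : 0 < ρ) (z : ℂ) :
    IntegrableOn (fun r : ℝ => mWright β r * ((r ^ (ρ - 1) : ℝ) : ℂ) * cexp (-(r : ℂ) * z))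
      (Ioi 0) :=
  integrableOn_mul_rpow_mul_cexp (continuous_mWright hβ₀ hβ₁).aestronglyMeasurable
    (integrableOn_norm_mWright_mul_rpow_mul_exp hβ₀ hβ₁ hρ ‖z‖)

theorem hasSum_laplaceFoxTerm (hβ₀ : 0 < β) (hβ₁ : β < 1) (hρ : 0 < ρ) (z : ℂ) :
    HasSum (laplaceFoxTerm β ρ z) (∫ r in Ioi (0 : ℝ),
      mWright β r * ((r ^ (ρ - 1) : ℝ) : ℂ) * cexp (-(r : ℂ) * z)) := by
  refine (hasSum_mellin_laplace (continuous_mWright hβ₀ hβ₁).aestronglyMeasurable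
    (integrableOn_norm_mWright_mul_rpow_mul_exp hβ₀ hβ₁ hρ ‖z‖)).congr_fun fun k => ?_
  have hk : 0 < ((ρ : ℂ) + k).re := by
    simpa using by positivity
  rw [mellin_mWright hβ₀ hβ₁ hk, laplaceFoxTerm, mul_add, ← add_assoc, div_eq_mul_inv,
    div_eq_mul_inv, mul_inv]
  ring

theorem analyticAt_tsum_laplaceFoxTerm (hsum : ∀ z, Summable (laplaceFoxTerm β ρ z)) (z : ℂ) :
    AnalyticAt ℂ (fun u => ∑' k, laplaceFoxTerm β ρ u k) z := by
  have hterm (u : ℂ) (k : ℕ) : laplaceFoxTerm β ρ u k = laplaceFoxTerm β ρ 1 k * u ^ k := by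
    rw [laplaceFoxTerm, laplaceFoxTerm, neg_pow]
    ring
  rw [funext fun u => tsum_congr (hterm u)]
  exact (differentiable_tsum_mul_pow fun r => (hsum r).congr (hterm r)).analyticAt z

theorem laplaceFoxParams_hasFoxH (hβ : 0 < β) (hρ : 0 < ρ)
    (hsum : ∀ z, Summable (laplaceFoxTerm β ρ z)) (z : ℂ) :
    (laplaceFoxParams β ρ).HasFoxH z (∑' k, laplaceFoxTerm β ρ z k) := by
  have hcontour {u : ℂ} (hu : u ≠ 0) := laplaceFoxParams_hasContourValue hβ hρ hu (hsum u).hasSum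
  refine ⟨laplaceFoxParams_valid hβ ρ, ?_⟩
  rcases eq_or_ne z 0 with rfl | hz
  · exact .inr ⟨rfl, _, analyticAt_tsum_laplaceFoxTerm hsum 0, rfl,
      eventually_mem_nhdsWithin.mono fun _ => hcontour⟩
  · exact .inl ⟨hz, hcontour hz⟩

theorem laplaceFoxTerm_one (β : ℝ) (z : ℂ) (k : ℕ) :
    laplaceFoxTerm β 1 z k = (-z) ^ k / Gamma (β * k + 1) := by
  have hfact : Gamma (1 + k) = k.factorial := by rw [add_comm, Gamma_nat_eq_factorial]
  have harg : 1 - (β : ℂ) + β * 1 + β * k = β * k + 1 := by ring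
  have hne : (k.factorial : ℂ) ≠ 0 := Nat.cast_ne_zero.2 k.factorial_ne_zero
  rw [laplaceFoxTerm, ofReal_one, hfact, harg, mul_comm, mul_div_mul_left _ _ hne]

end Laplace

theorem mainTheorem10_general (β : ℝ) (hβ₀ : 0 < β) (hβ₁ : β < 1) :
    (∀ ρ : ℝ, 0 < ρ → ∀ z : ℂ,
      IntegrableOn (fun r : ℝ => mWright β r * ((r ^ (ρ - 1) : ℝ) : ℂ) * cexp (-(r : ℂ) * z))
        (Ioi 0) ∧
      (laplaceFoxParams β ρ).HasFoxH z ((laplaceFoxParams β ρ).foxH z) ∧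
      (∫ r in Ioi (0 : ℝ), mWright β r * ((r ^ (ρ - 1) : ℝ) : ℂ) * cexp (-(r : ℂ) * z)) =
        (laplaceFoxParams β ρ).foxH z ∧
      HasSum (fun k : ℕ => (-z) ^ k * Gamma ((ρ : ℂ) + k) /
          ((k.factorial : ℂ) * Gamma (1 - (β : ℂ) + β * ρ + β * k)))
        ((laplaceFoxParams β ρ).foxH z)) ∧
    (∀ z : ℂ,
      IntegrableOn (fun r : ℝ => mWright β r * cexp (-(r : ℂ) * z)) (Ioi 0) ∧
      (∫ r in Ioi (0 : ℝ), mWright β r * cexp (-(r : ℂ) * z)) = mittagLeffler β (-z)) := by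
  refine ⟨fun ρ hρ z => ?_, fun z => ?_⟩
  · have hsum := hasSum_laplaceFoxTerm hβ₀ hβ₁ hρ
    have hfox := laplaceFoxParams_hasFoxH hβ₀ hρ (fun u => (hsum u).summable) z
    rw [hfox.foxH_eq]
    exact ⟨integrableOn_mWright_laplace hβ₀ hβ₁ hρ z, hfox, (hsum z).tsum_eq.symm,
      (hsum z).summable.hasSum⟩
  · have hInt := integrableOn_mWright_laplace hβ₀ hβ₁ one_pos z
    have hsum := (hasSum_laplaceFoxTerm hβ₀ hβ₁ one_pos z).tsum_eq
    simp only [sub_self, Real.rpow_zero, ofReal_one, mul_one] at hInt hsum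
    refine ⟨hInt, ?_⟩
    rw [← hsum, mittagLeffler]
    simp only [laplaceFoxTerm_one]

theorem mainTheorem10 (β : ℝ) (hβ₀ : 0 < β) (hβ₁ : β < 1) :
    (∀ ρ : ℝ, 1 / 2 ≤ ρ → ∀ z : ℂ,
      MeasureTheory.IntegrableOn
        (fun r : ℝ => mWright β r * ((r ^ (ρ - 1) : ℝ) : ℂ) * Complex.exp (-(r : ℂ) * z))
        (Set.Ioi 0) ∧
      (laplaceFoxParams β ρ).HasFoxH z ((laplaceFoxParams β ρ).foxH z) ∧
      (∫ r in Set.Ioi (0 : ℝ),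
          mWright β r * ((r ^ (ρ - 1) : ℝ) : ℂ) * Complex.exp (-(r : ℂ) * z)) =
        (laplaceFoxParams β ρ).foxH z ∧
      HasSum
        (fun k : ℕ => (-z) ^ k * Complex.Gamma ((ρ : ℂ) + k) /
          ((k.factorial : ℂ) * Complex.Gamma (1 - (β : ℂ) + β * ρ + β * k)))
        ((laplaceFoxParams β ρ).foxH z)) ∧
    (∀ z : ℂ,
      MeasureTheory.IntegrableOn
        (fun r : ℝ => mWright β r * Complex.exp (-(r : ℂ) * z)) (Set.Ioi 0) ∧
      (∫ r in Set.Ioi (0 : ℝ), mWright β r * Complex.exp (-(r : ℂ) * z)) =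
        mittagLeffler β (-z)) :=
  ⟨fun ρ hρ => (mainTheorem10_general β hβ₀ hβ₁).1 ρ (by linarith),
    (mainTheorem10_general β hβ₀ hβ₁).2⟩
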